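/- Let $H$ and $U$ be complex Hilbert spaces and let $A$ be the infinitesimal generator of a $C_0$-semigroup $(e^{At})_{t\ge 0}$ on $H$, with spectrum $\sigma(A)$ and spectral bound $s(A)=\sup\{\operatorname{Re}\lambda : \lambda\in\sigma(A)\}$ ($s(A)=-\infty$ if $\sigma(A)=\emptyset$). Let $\operatorname{dom}A^*$ carry the graph norm $|v|^2_{*}=|v|^2+|A^*v|^2$, and let $(\operatorname{dom}A^*)'$ be its dual space of bounded conjugate-linear functionals, into which $H$ is embedded by $y\mapsto\langle\,\cdot\,,y\rangle$ (the inner product being conjugate-linear in the first slot). Let $e^{\mathcal A t}$ be the semigroup on $(\operatorname{dom}A^*)'$ that extends $e^{At}$, namely the dual of $e^{A^*t}|_{\operatorname{dom}A^*}$: $(e^{\mathcal At}f)(v)=f(e^{A^*t}v)$. Let $B:U\to(\operatorname{dom}A^*)'$ be a bounded linear operator such that, for every $T>0$, the map $$u\mapsto Lu,\qquad (Lu)(t)=\int_0^t e^{\mathcal A(t-s)}Bu(s)\,ds,$$ is linear and continuous from $L^2(0,T;U)$ into $L^2(0,T;H)$. For $y_0\in H$ and a control $u\in L^2_{\rm loc}(0,+\infty;U)$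 let $y^{y_0,u}(t)=e^{At}y_0+(Lu)(t)$, $t\ge0$, be the solution of $$\dot y=\mathcal A y+Bu,\qquad y(0)=y_0. \tag{1}$$ The control $u$ steers $y_0$ to the rest in time at most $T>0$ if $u$ and $y^{y_0,u}$ both have support contained in $[0,T]$. System (1) is null controllable if for every $y_0\in H$ there are $T>0$ and a control that steers $y_0$ to the rest in time at most $T$. System (1) is NCVE (null controllable with vanishing energy) if for every $y_0\in H$ and every $\epsilon>0$ there are $T>0$ and a control $u$ that steers $y_0$ to the rest in time at most $T$ and satisfies $\int_0^{+\infty}|u(s)|^2\,ds\le\epsilon^2$. Suppose that the semigroup is eventually compact, i.e. there is $t_0>0$ such that $e^{At}$ is a compact operator for all $t\ge t_0$. Then: 1. if $s(A)\le 0$, then system (1) is null controllable if and only if it is NCVE; 2. if $s(A)>0$, then system (1) is not NCVE. -/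

import Mathlib

open MeasureTheory Set Filter Topology
open scoped NNReal ENNReal InnerProductSpace

noncomputable section

/-- A strongly continuous (`C₀`) semigroup `(S(t))_{t ≥ 0}` of bounded operators on `H`. -/
structure C0Semigroup (H : Type*) [NormedAddCommGroup H] [InnerProductSpace ℂ H] where
  toFun : ℝ≥0 → H →L[ℂ] H
  map_zero' : toFun 0 = ContinuousLinearMap.id ℂ H
  map_add' : ∀ s t, toFun (s + t) = (toFun s).comp (toFun t)
  continuous_orbit' : ∀ x, Continuous fun t => toFun t x

namespace C0Semigroup

variable {H : Type*} [NormedAddCommGroup H] [InnerProductSpace ℂ H]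

instance : CoeFun (C0Semigroup H) fun _ => ℝ≥0 → H →L[ℂ] H := ⟨toFun⟩

variable (S : C0Semigroup H)

/-- `y` is the right derivative at `0` of the orbit `t ↦ S(t) x`. -/
def HasGenerator (x y : H) : Prop :=
  Tendsto (fun h : ℝ≥0 => (h : ℝ)⁻¹ • (S h x - x)) (𝓝[>] 0) (𝓝 y)

variable {S} in
theorem HasGenerator.add {x y x' y' : H} (h : S.HasGenerator x y) (h' : S.HasGenerator x' y') :
    S.HasGenerator (x + x') (y + y') := by
  refine (Tendsto.add h h').congr fun t => ?_
  rw [← smul_add, map_add]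
  congr 1
  abel

variable {S} in
theorem HasGenerator.smul {x y : H} (c : ℂ) (h : S.HasGenerator x y) :
    S.HasGenerator (c • x) (c • y) := by
  refine (Tendsto.const_smul h c).congr fun t => ?_
  rw [map_smul, ← smul_sub, smul_comm]

theorem hasGenerator_zero : S.HasGenerator 0 0 := by
  simp [HasGenerator]

/-- The infinitesimal generator `A` of the semigroup, with domain the set of all `x` for which
`lim_{h → 0+} (S(h) x - x) / h` exists, and with `A x` that limit. -/
def generator : H →ₗ.[ℂ] H where
  domain :=
    { carrier := {x | ∃ y, S.HasGenerator x y}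
      add_mem' := fun ⟨_, h⟩ ⟨_, h'⟩ => ⟨_, h.add h'⟩
      zero_mem' := ⟨0, S.hasGenerator_zero⟩
      smul_mem' := fun c _ ⟨_, h⟩ => ⟨_, h.smul c⟩ }
  toFun :=
    { toFun := fun x => x.2.choose
      map_add' := fun x x' =>
        tendsto_nhds_unique (x + x').2.choose_spec (x.2.choose_spec.add x'.2.choose_spec)
      map_smul' := fun c x =>
        tendsto_nhds_unique (c • x).2.choose_spec (x.2.choose_spec.smul c) }

theorem hasGenerator_generator (x : S.generator.domain) : S.HasGenerator x (S.generator x) :=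
  x.2.choose_spec

variable {S} in
theorem HasGenerator.map {x y : H} (h : S.HasGenerator x y) (t : ℝ≥0) :
    S.HasGenerator (S t x) (S t y) := by
  refine (((S t).continuous.tendsto y).comp h).congr fun s => ?_
  have hst : S s (S t x) = S t (S s x) := by
    rw [← ContinuousLinearMap.comp_apply, ← ContinuousLinearMap.comp_apply, ← S.map_add',
      ← S.map_add', add_comm]
  change S t _ = _
  rw [(S t).map_smul_of_tower, map_sub, hst]

/-- The domain of `A` is invariant under the semigroup. -/
theorem map_mem_domain (t : ℝ≥0) (x : S.generator.domain) : S t x ∈ S.generator.domain :=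
  ⟨_, (S.hasGenerator_generator x).map t⟩

/-- The semigroup commutes with its generator. -/
theorem generator_map (t : ℝ≥0) (x : S.generator.domain) :
    S.generator ⟨S t x, S.map_mem_domain t x⟩ = S t (S.generator x) :=
  tendsto_nhds_unique (S.hasGenerator_generator ⟨S t x, S.map_mem_domain t x⟩)
    ((S.hasGenerator_generator x).map t)

/-- The resolvent set `ρ(A)`: those `z` for which `z - A : dom A → H` has a bounded two-sided
inverse `R`. -/
def resolventSet : Set ℂ :=
  {z | ∃ R : H →L[ℂ] H,
    (∀ x : H, ∃ hx : R x ∈ S.generator.domain, z • R x - S.generator ⟨R x, hx⟩ = x) ∧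
    ∀ x : S.generator.domain, R (z • (x : H) - S.generator x) = x}

/-- The spectrum `σ(A)`. -/
def spectrum : Set ℂ := S.resolventSetᶜ

/-- The spectral bound `s(A) = sup {Re z | z ∈ σ(A)}`, equal to `-∞` when `σ(A) = ∅`. -/
def spectralBound : EReal := ⨆ z ∈ S.spectrum, ((z.re : ℝ) : EReal)

/-- There is `t₀ > 0` such that `S(t)` is a compact operator for all `t ≥ t₀`. -/
def EventuallyCompact : Prop := ∃ t₀ : ℝ≥0, 0 < t₀ ∧ ∀ t ≥ t₀, IsCompactOperator (S t)

variable [CompleteSpace H]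

/-- The space `dom A*` with the graph inner product `⟪v, w⟫ + ⟪A* v, A* w⟫`, realised as the set
of all pairs `(v, A* v)` inside the Hilbert sum `H ⊕ H`. -/
def DomAdjoint : Submodule ℂ (WithLp 2 (H × H)) :=
  S.generator.adjoint.graph.comap (WithLp.linearEquiv 2 ℂ (H × H)).toLinearMap

/-- The inclusion `dom A* → H`. -/
def inclDomAdjoint : S.DomAdjoint →L[ℂ] H := (WithLp.fstL 2 ℂ H H).comp S.DomAdjoint.subtypeL

/-- The operator `S(t)* ⊕ S(t)*` on the Hilbert sum `H ⊕ H`. -/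
def adjointProd (t : ℝ≥0) : WithLp 2 (H × H) →L[ℂ] WithLp 2 (H × H) :=
  ((WithLp.prodContinuousLinearEquiv 2 ℂ H H).symm : H × H →L[ℂ] WithLp 2 (H × H)).comp
    (((S t).adjoint.prodMap (S t).adjoint).comp
      (WithLp.prodContinuousLinearEquiv 2 ℂ H H : WithLp 2 (H × H) →L[ℂ] H × H))

theorem adjointProd_mem (t : ℝ≥0) (p : WithLp 2 (H × H)) (hp : p ∈ S.DomAdjoint) :
    S.adjointProd t p ∈ S.DomAdjoint := by
  obtain ⟨v, hv₁, hv₂⟩ := (LinearPMap.mem_graph_iff _).1 hp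
  have key : ∀ (φ : H) (x : S.generator.domain),
      inner ℂ ((S t).adjoint φ) (S.generator x) =
        inner ℂ φ (S.generator ⟨S t x, S.map_mem_domain t x⟩) := fun φ x => by
    rw [ContinuousLinearMap.adjoint_inner_left, generator_map]
  have hmem : (S t).adjoint (v : H) ∈ S.generator.adjoint.domain := by
    refine (S.generator.mem_adjoint_domain_iff _).2 ?_
    have hc : Continuous fun x : S.generator.domain =>
        (⟨S t x, S.map_mem_domain t x⟩ : S.generator.domain) :=
      ((S t).continuous.comp continuous_subtype_val).subtype_mk _
    exact (((S.generator.mem_adjoint_domain_iff _).1 v.2).comp hc).congr fun x => (key v x).symm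
  refine (LinearPMap.mem_graph_iff _).2 ⟨⟨_, hmem⟩, ?_, ?_⟩
  · exact congrArg (S t).adjoint hv₁
  · change _ = (S t).adjoint (p.snd)
    have hv₂' : S.generator.adjoint v = p.snd := hv₂
    rw [← hv₂']
    by_cases hd : Dense (S.generator.domain : Set H)
    · refine LinearPMap.adjoint_apply_eq hd _ fun x => ?_
      rw [ContinuousLinearMap.adjoint_inner_left, key]
      exact LinearPMap.adjoint_isFormalAdjoint hd v ⟨S t x, S.map_mem_domain t x⟩
    · rw [LinearPMap.adjoint_apply_of_not_dense hd, LinearPMap.adjoint_apply_of_not_dense hd,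
        map_zero]

/-- The restriction of `S(t)* = e^{A* t}` to `dom A*`, a bounded operator for the graph norm. -/
def adjointOnDom (t : ℝ≥0) : S.DomAdjoint →L[ℂ] S.DomAdjoint :=
  (S.adjointProd t).restrict (S.adjointProd_mem t)

/-- The extrapolation space `(dom A*)'`: bounded functionals on `dom A*` (with its graph norm),
taken conjugate-linear so that the embedding `y ↦ ⟪·, y⟫` of `H` into it is complex linear. -/
abbrev DualDom : Type _ := S.DomAdjoint →L⋆[ℂ] ℂ

/-- The embedding `H ⊂ (dom A*)'`, sending `y` to the functional `v ↦ ⟪v, y⟫`. -/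
def embed : H →L[ℂ] S.DualDom :=
  LinearMap.mkContinuous
    { toFun := fun y => ((innerSL ℂ : H →L⋆[ℂ] H →L[ℂ] ℂ).flip y).comp S.inclDomAdjoint
      map_add' := fun x y => by ext v; simp
      map_smul' := fun c x => by ext v; simp }
    ‖S.inclDomAdjoint‖ (fun y => by
      refine ContinuousLinearMap.opNorm_le_bound _ (by positivity) fun v => ?_
      change ‖inner ℂ (S.inclDomAdjoint v) y‖ ≤ _
      have h₁ := norm_inner_le_norm (𝕜 := ℂ) (S.inclDomAdjoint v) y
      have h₂ := mul_le_mul_of_nonneg_right (S.inclDomAdjoint.le_opNorm v) (norm_nonneg y)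
      linarith [mul_right_comm ‖S.inclDomAdjoint‖ ‖v‖ ‖y‖])

/-- The semigroup `e^{𝒜 t}` on `(dom A*)'`, the dual of the semigroup `e^{A* t}` on `dom A*`. -/
def extend (t : ℝ≥0) (f : S.DualDom) : S.DualDom := f.comp (S.adjointOnDom t)

/-- `e^{𝒜 t}` extends `e^{A t}`. -/
theorem extend_embed (t : ℝ≥0) (y : H) : S.extend t (S.embed y) = S.embed (S t y) := by
  ext v
  exact (S t).adjoint_inner_left y (S.inclDomAdjoint v)

variable {U : Type*} [NormedAddCommGroup U] [InnerProductSpace ℂ U] [CompleteSpace U]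
variable (B : U →L[ℂ] S.DualDom)

/-- The input map `(L u)(t) = ∫_0^t e^{𝒜 (t - s)} B u(s) ds`, an integral in `(dom A*)'`. -/
def inputMap (u : ℝ → U) (t : ℝ) : S.DualDom :=
  ∫ s in (0 : ℝ)..t, S.extend (t - s).toNNReal (B (u s))

/-- For every `T > 0`, the map `u ↦ L u` is linear and continuous from `L²(0,T;U)` into
`L²(0,T;H)`. -/
def Admissible : Prop :=
  ∀ T : ℝ, 0 < T →
    ∃ Λ : Lp U 2 (volume.restrict (Ioo 0 T)) →L[ℂ] Lp H 2 (volume.restrict (Ioo 0 T)),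
      ∀ u, ∀ᵐ t ∂volume.restrict (Ioo 0 T), S.embed (Λ u t) = S.inputMap B u t

/-- A control: an element of `L²_loc(0,+∞;U)`, i.e. square integrable on `(0,T)` for all `T`. -/
def IsControl (u : ℝ → U) : Prop :=
  ∀ T : ℝ, 0 < T → MemLp u 2 (volume.restrict (Ioo 0 T))

/-- The solution `y(t) = e^{A t} y₀ + ∫_0^t e^{𝒜 (t - s)} B u(s) ds`, `t ≥ 0`, of
`y' = 𝒜 y + B u`, `y(0) = y₀`, as a function with values in `(dom A*)'`. -/
def solution (y₀ : H) (u : ℝ → U) (t : ℝ) : S.DualDom :=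
  S.embed (S t.toNNReal y₀) + S.inputMap B u t

/-- The control `u` steers `y₀` to the rest in time at most `T`: both `u` and the corresponding
solution, as (classes of) functions on `(0,+∞)`, have support in `[0,T]`. -/
def SteersToRest (y₀ : H) (u : ℝ → U) (T : ℝ) : Prop :=
  IsControl u ∧ (∀ᵐ t ∂volume.restrict (Ioi T), u t = 0) ∧
    ∀ᵐ t ∂volume.restrict (Ioi T), S.solution B y₀ u t = 0

/-- Every `y₀ ∈ H` can be steered to the rest in some time (depending on `y₀`). -/
def NullControllable : Prop :=
  ∀ y₀ : H, ∃ T : ℝ, 0 < T ∧ ∃ u : ℝ → U, S.SteersToRest B y₀ u T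

/-- Null controllability with vanishing energy: every `y₀ ∈ H` can be steered to the rest, in a
time that may depend on `ε`, by controls of `L²(0,+∞;U)` norm at most `ε`, for every `ε > 0`. -/
def NCVE : Prop :=
  ∀ y₀ : H, ∀ ε : ℝ, 0 < ε → ∃ T : ℝ, 0 < T ∧ ∃ u : ℝ → U,
    S.SteersToRest B y₀ u T ∧ ∫ s in Ioi (0 : ℝ), ‖u s‖ ^ 2 ≤ ε ^ 2

end C0Semigroup

end

/-! Stable case. If every state can be steered to rest, Banach–Steinhaus and the open mapping
theorem give one time `n` and a constant `C` such that each `y` is brought to `0` at time `n` with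
cost at most `C * ‖y‖`. Leaving the control off for one more unit of time puts the reached states in
`H`, so sampling at `τ = 1 + n` gives a discrete system `y ↦ K y + Φ w` on `H`, where `K = S τ` may
be taken compact.

Let `p` be the infimum of the `ℓ²` costs of steering to `0`. It is a seminorm bounded by `C * ‖·‖`,
with `p y ^ 2 ≤ ‖w‖ ^ 2 + p (K y + Φ w) ^ 2`. Thus `p y ≤ p (K y)`: waiting never makes steering
cheaper. Equality forces `p y = 0`, because applying a fraction `ε` of a control that kills `y`
costs only order `ε ^ 2` but lowers `p` at first order in `ε` (`steerInf_eq_zero_of_map_le`). Let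
`N` be the largest `K`-invariant subspace on which `p` vanishes, and let `T` be the compression of
`K` to its orthogonal complement. An eigenvector of `T` with eigenvalue `z ≠ 0` satisfies `p (K v) =
|z| p v`; as `|z| ≤ 1`, it would lie in `N`, which `T` kills. So the compact operator `T` is
quasinilpotent, and `p y ≤ p (K ^ n y) ≤ C * ‖T ^ n y‖` tends to `0` (`steerInf_eq_zero`). The bound
`spectralRadius K ≤ 1` comes from `s(A) ≤ 0` by a Fourier argument on orbits of eigenvectors
(`eq_zero_of_map_eq_exp_smul`).

Unstable case. Spectral inclusion and compactness give `S(τ)*` an eigenvalue of modulus greater than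
`1`, with an eigenvector `p` in `dom A*`. The free evolution amplifies `⟪p, y⟫` exponentially, and
the control must cancel this growth; Cauchy–Schwarz then bounds `|⟪p, y⟫|` by a constant times the
`L²` norm of the control (`SteersToRest.exists_norm_inner_le`). -/

/-! ### Discrete-time null controllability with vanishing energy -/

section Discrete

variable {H W : Type*} [NormedAddCommGroup H] [InnerProductSpace ℂ H]
  [NormedAddCommGroup W] [InnerProductSpace ℂ W]

/-- `SteerCost K Φ n y c`: the state `y` of `y_{k+1} = K y_k + Φ w_k` can be brought to `0` in
`n` steps by controls of `ℓ²` norm at most `c`. -/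
def SteerCost (K : H →L[ℂ] H) (Φ : W →L[ℂ] H) : ℕ → H → ℝ → Prop
  | 0, y, c => y = 0 ∧ 0 ≤ c
  | n + 1, y, c => 0 ≤ c ∧ ∃ w : W, ∃ c' : ℝ, SteerCost K Φ n (K y + Φ w) c' ∧
      ‖w‖ ^ 2 + c' ^ 2 ≤ c ^ 2

namespace SteerCost

variable {K : H →L[ℂ] H} {Φ : W →L[ℂ] H}

theorem nonneg {n : ℕ} {y : H} {c : ℝ} (h : SteerCost K Φ n y c) : 0 ≤ c := by
  cases n with
  | zero => exact h.2
  | succ n => exact h.1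

theorem mono {n : ℕ} {y : H} {c d : ℝ} (h : SteerCost K Φ n y c) (hcd : c ≤ d) :
    SteerCost K Φ n y d := by
  have hc := h.nonneg
  cases n with
  | zero => exact ⟨h.1, hc.trans hcd⟩
  | succ n =>
    obtain ⟨-, w, c', h1, h2⟩ := h
    exact ⟨hc.trans hcd, w, c', h1, h2.trans (by gcongr)⟩

theorem succ {n : ℕ} {y : H} {c : ℝ} (h : SteerCost K Φ n y c) : SteerCost K Φ (n + 1) y c := by
  induction n generalizing y c with
  | zero =>
    obtain ⟨rfl, hc⟩ := h
    exact ⟨hc, 0, 0, ⟨by simp, le_rfl⟩, by simpa using sq_nonneg c⟩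
  | succ n ih =>
    obtain ⟨hc, w, c', h1, h2⟩ := h
    exact ⟨hc, w, c', ih h1, h2⟩

theorem of_le {m n : ℕ} {y : H} {c : ℝ} (h : SteerCost K Φ m y c) (hmn : m ≤ n) :
    SteerCost K Φ n y c :=
  Nat.le_induction h (fun _ _ h => h.succ) n hmn

theorem add {n : ℕ} {x y : H} {a b : ℝ} (hx : SteerCost K Φ n x a) (hy : SteerCost K Φ n y b) :
    SteerCost K Φ n (x + y) (a + b) := by
  induction n generalizing x y a b with
  | zero => exact ⟨by simp [hx.1, hy.1], add_nonneg hx.2 hy.2⟩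
  | succ n ih =>
    obtain ⟨ha, w, c, h1, h2⟩ := hx
    obtain ⟨hb, w', c', h1', h2'⟩ := hy
    refine ⟨add_nonneg ha hb, w + w', c + c', ?_, ?_⟩
    · convert ih h1 h1' using 1
      simp only [map_add]
      abel
    · have h3 : ‖w + w'‖ ^ 2 ≤ (‖w‖ + ‖w'‖) ^ 2 := by
        gcongr
        exact norm_add_le _ _
      -- Cauchy–Schwarz in the plane; the square passed to `nlinarith` is the defect in Lagrange's
      -- identity.
      have h4 : (‖w‖ * ‖w'‖ + c * c') ^ 2 ≤ (a * b) ^ 2 := by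
        have h5 := mul_le_mul h2 h2' (by positivity) (by positivity)
        nlinarith [sq_nonneg (‖w‖ * c' - ‖w'‖ * c)]
      have h6 := abs_le_of_sq_le_sq' h4 (mul_nonneg ha hb)
      nlinarith [h6.2]

theorem smul {n : ℕ} {x : H} {a : ℝ} (t : ℂ) (hx : SteerCost K Φ n x a) :
    SteerCost K Φ n (t • x) (‖t‖ * a) := by
  induction n generalizing x a with
  | zero => exact ⟨by simp [hx.1], mul_nonneg (norm_nonneg _) hx.2⟩
  | succ n ih =>
    obtain ⟨ha, w, c, h1, h2⟩ := hx
    refine ⟨by positivity, t • w, ‖t‖ * c, ?_, ?_⟩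
    · convert ih h1 using 1
      simp only [map_smul, smul_add]
    · rw [norm_smul]
      nlinarith [mul_le_mul_of_nonneg_left h2 (sq_nonneg ‖t‖)]

end SteerCost

/-- The infimum of the `ℓ²` norms of the controls which steer `y` to `0` in finite time. -/
noncomputable def steerInf (K : H →L[ℂ] H) (Φ : W →L[ℂ] H) (y : H) : ℝ :=
  sInf {c | ∃ n, SteerCost K Φ n y c}

section SteerInf

variable {K : H →L[ℂ] H} {Φ : W →L[ℂ] H}

theorem steerInf_le {n : ℕ} {y : H} {c : ℝ} (h : SteerCost K Φ n y c) : steerInf K Φ y ≤ c :=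
  csInf_le ⟨0, by rintro _ ⟨m, hm⟩; exact hm.nonneg⟩ (Set.mem_ofPred.2 ⟨n, h⟩)

theorem steerInf_nonneg (y : H) : 0 ≤ steerInf K Φ y :=
  Real.sInf_nonneg (by rintro _ ⟨_, h⟩; exact h.nonneg)

variable {C : ℝ} (hC : 0 ≤ C) (hKΦ : ∀ y, ∃ w, K y + Φ w = 0 ∧ ‖w‖ ≤ C * ‖y‖)
include hC hKΦ

theorem exists_steerCost (y : H) : SteerCost K Φ 1 y (C * ‖y‖) := by
  obtain ⟨w, h1, h2⟩ := hKΦ y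
  refine ⟨by positivity, w, 0, ⟨h1, le_rfl⟩, ?_⟩
  simp only [ne_eq, OfNat.ofNat_ne_zero, not_false_eq_true, zero_pow, add_zero]
  gcongr

theorem steerInf_le_mul_norm (y : H) : steerInf K Φ y ≤ C * ‖y‖ :=
  steerInf_le (exists_steerCost hC hKΦ y)

theorem exists_steerCost_lt (y : H) {c : ℝ} (hc : steerInf K Φ y < c) :
    ∃ n, SteerCost K Φ n y c := by
  obtain ⟨d, ⟨n, hd⟩, hdc⟩ :=
    exists_lt_of_csInf_lt (s := {c | ∃ n, SteerCost K Φ n y c})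
      ⟨_, Set.mem_ofPred.2 ⟨1, exists_steerCost hC hKΦ y⟩⟩ hc
  exact ⟨n, hd.mono hdc.le⟩

theorem steerInf_add_le (x y : H) :
    steerInf K Φ (x + y) ≤ steerInf K Φ x + steerInf K Φ y := by
  refine le_of_forall_pos_le_add fun ε hε => ?_
  obtain ⟨m, hm⟩ := exists_steerCost_lt hC hKΦ x (lt_add_of_pos_right _ (half_pos hε))
  obtain ⟨n, hn⟩ := exists_steerCost_lt hC hKΦ y (lt_add_of_pos_right _ (half_pos hε))
  have := steerInf_le ((hm.of_le (le_max_left m n)).add (hn.of_le (le_max_right m n)))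
  linarith

theorem steerInf_smul_le (t : ℂ) (x : H) : steerInf K Φ (t • x) ≤ ‖t‖ * steerInf K Φ x := by
  refine le_of_forall_pos_le_add fun ε hε => ?_
  -- The `+ 1` covers `t = 0`.
  obtain ⟨m, hm⟩ := exists_steerCost_lt hC hKΦ x
    (lt_add_of_pos_right (steerInf K Φ x) (show 0 < ε / (‖t‖ + 1) by positivity))
  refine (steerInf_le (hm.smul t)).trans ?_
  rw [mul_add]
  gcongr
  rw [mul_div_assoc', div_le_iff₀ (by positivity)]
  nlinarith

/-- Dynamic programming: play `w` first, then continue almost optimally. The infimum need not be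
attained, so the bound is proved for every larger `c` and passed to the limit. -/
theorem steerInf_sq_le (y : H) (w : W) :
    steerInf K Φ y ^ 2 ≤ ‖w‖ ^ 2 + steerInf K Φ (K y + Φ w) ^ 2 := by
  have key : ∀ c, steerInf K Φ (K y + Φ w) < c → steerInf K Φ y ^ 2 ≤ ‖w‖ ^ 2 + c ^ 2 := by
    intro c hc
    obtain ⟨n, hn⟩ := exists_steerCost_lt hC hKΦ _ hc
    have h1 : SteerCost K Φ (n + 1) y (√(‖w‖ ^ 2 + c ^ 2)) :=
      ⟨by positivity, w, c, hn, by rw [Real.sq_sqrt (by positivity)]⟩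
    calc steerInf K Φ y ^ 2 ≤ (√(‖w‖ ^ 2 + c ^ 2)) ^ 2 := by
          have := steerInf_nonneg (K := K) (Φ := Φ) y
          gcongr
          exact steerInf_le h1
      _ = _ := Real.sq_sqrt (by positivity)
  have hcont : Tendsto (fun c : ℝ => ‖w‖ ^ 2 + c ^ 2) (𝓝[>] (steerInf K Φ (K y + Φ w)))
      (𝓝 (‖w‖ ^ 2 + steerInf K Φ (K y + Φ w) ^ 2)) :=
    ((by fun_prop : Continuous fun c : ℝ => ‖w‖ ^ 2 + c ^ 2).tendsto _).mono_left
      nhdsWithin_le_nhds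
  exact ge_of_tendsto hcont (by filter_upwards [self_mem_nhdsWithin] with c hc using key c hc)

theorem steerInf_le_steerInf_map (y : H) : steerInf K Φ y ≤ steerInf K Φ (K y) := by
  have := steerInf_sq_le hC hKΦ y 0
  simp only [norm_zero, map_zero, add_zero, ne_eq, OfNat.ofNat_ne_zero, not_false_eq_true,
    zero_pow, zero_add] at this
  exact (abs_le_of_sq_le_sq' this (steerInf_nonneg _)).2

theorem steerInf_le_steerInf_pow (n : ℕ) (y : H) :
    steerInf K Φ y ≤ steerInf K Φ ((K ^ n) y) := by
  induction n with
  | zero => simp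
  | succ n ih =>
    refine ih.trans ((steerInf_le_steerInf_map hC hKΦ _).trans_eq ?_)
    rw [pow_succ', mul_apply_eq_comp]

/-- A state whose cost does not increase along the free evolution has cost zero. -/
theorem steerInf_eq_zero_of_map_le {y : H} (h : steerInf K Φ (K y) ≤ steerInf K Φ y) :
    steerInf K Φ y = 0 := by
  obtain ⟨w, hw, -⟩ := hKΦ y
  have hp := steerInf_nonneg (K := K) (Φ := Φ) y
  -- With `Φ w = -K y`, the control `ε w` leads to `(1 - ε) K y`. Hence `p² ≤ ε² ‖w‖² + (1 - ε)²
  -- p²`; cancelling one factor `ε` leaves this inequality, and `ε → 0` gives `2 p² ≤ 0`.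
  have key : ∀ ε : ℝ, 0 < ε → ε < 1 → (2 - ε) * steerInf K Φ y ^ 2 ≤ ε * ‖w‖ ^ 2 := by
    intro ε hε hε1
    have h1 := steerInf_sq_le hC hKΦ y ((ε : ℂ) • w)
    have h2 : K y + Φ ((ε : ℂ) • w) = ((1 - ε : ℝ) : ℂ) • K y := by
      rw [map_smul, eq_neg_of_add_eq_zero_right hw]
      push_cast
      module
    have h3 : steerInf K Φ (K y + Φ ((ε : ℂ) • w)) ≤ (1 - ε) * steerInf K Φ y := by
      rw [h2]
      refine (steerInf_smul_le hC hKΦ _ _).trans ?_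
      rw [Complex.norm_real, Real.norm_of_nonneg (by linarith)]
      gcongr
    have h4 : steerInf K Φ (K y + Φ ((ε : ℂ) • w)) ^ 2 ≤ ((1 - ε) * steerInf K Φ y) ^ 2 :=
      pow_le_pow_left₀ (steerInf_nonneg _) h3 2
    rw [norm_smul, Complex.norm_real, Real.norm_of_nonneg hε.le] at h1
    have h5 : ε * ((2 - ε) * steerInf K Φ y ^ 2) ≤ ε * (ε * ‖w‖ ^ 2) := by nlinarith
    exact le_of_mul_le_mul_left h5 hε
  have hl : Tendsto (fun ε : ℝ => (2 - ε) * steerInf K Φ y ^ 2) (𝓝[>] 0)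
      (𝓝 ((2 - 0) * steerInf K Φ y ^ 2)) :=
    ((by fun_prop : Continuous fun ε : ℝ => (2 - ε) * steerInf K Φ y ^ 2).tendsto _).mono_left
      nhdsWithin_le_nhds
  have hr : Tendsto (fun ε : ℝ => ε * ‖w‖ ^ 2) (𝓝[>] 0) (𝓝 (0 * ‖w‖ ^ 2)) :=
    ((by fun_prop : Continuous fun ε : ℝ => ε * ‖w‖ ^ 2).tendsto _).mono_left
      nhdsWithin_le_nhds
  have := le_of_tendsto_of_tendsto hl hr (by
    filter_upwards [Ioo_mem_nhdsGT (zero_lt_one' ℝ)] with ε hε using key ε hε.1 hε.2)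
  have h0 : steerInf K Φ y ^ 2 = 0 := le_antisymm (by linarith) (sq_nonneg _)
  simpa using h0

end SteerInf

/-- If `spectralRadius K ≤ 1` and `r ^ n ≤ ‖K ^ n‖` for all `n > 0`, then `r ≤ 1`. -/
theorem norm_le_one_of_pow_le [CompleteSpace H] {K : H →L[ℂ] H} (hK : spectralRadius ℂ K ≤ 1)
    {r : ℝ≥0} (h : ∀ n : ℕ, 0 < n → r ^ n ≤ ‖K ^ n‖₊) : r ≤ 1 := by
  have h1 := spectrum.pow_nnnorm_pow_one_div_tendsto_nhds_spectralRadius K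
  have h2 : (r : ℝ≥0∞) ≤ spectralRadius ℂ K := by
    refine ge_of_tendsto h1 ?_
    filter_upwards [eventually_gt_atTop 0] with n hn
    rw [one_div, ENNReal.le_rpow_inv_iff (by positivity), ENNReal.rpow_natCast]
    exact_mod_cast h n hn
  exact_mod_cast h2.trans hK

/-- By Gelfand's formula, `‖T ^ n‖` is eventually below `2⁻ⁿ`. -/
theorem tendsto_pow_apply_of_spectralRadius_eq_zero [CompleteSpace H] {T : H →L[ℂ] H}
    (hT : spectralRadius ℂ T = 0) (y : H) : Tendsto (fun n : ℕ => (T ^ n) y) atTop (𝓝 0) := by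
  have h1 := spectrum.pow_nnnorm_pow_one_div_tendsto_nhds_spectralRadius T
  rw [hT] at h1
  have h2 : ∀ᶠ n : ℕ in atTop, ‖(T ^ n) y‖ ≤ (1 / 2) ^ n * ‖y‖ := by
    filter_upwards [h1.eventually_lt_const (show (0 : ℝ≥0∞) < ((1 / 2 : ℝ≥0) : ℝ≥0∞) by simp),
      eventually_gt_atTop 0] with n hn hn0
    rw [one_div, ENNReal.rpow_inv_lt_iff (by positivity), ENNReal.rpow_natCast] at hn
    have h3 : ‖T ^ n‖₊ < (1 / 2) ^ n := by exact_mod_cast hn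
    have h4 : ‖T ^ n‖ ≤ (1 / 2) ^ n := by exact_mod_cast h3.le
    exact ((T ^ n).le_opNorm y).trans (by gcongr)
  refine squeeze_zero_norm' h2 ?_
  simpa using (tendsto_pow_atTop_nhds_zero_of_lt_one (by norm_num : (0 : ℝ) ≤ 1 / 2)
    (by norm_num)).mul_const ‖y‖

/-- A null controllable discrete-time system with compact `K` of spectral radius at most one is
null controllable with vanishing energy. -/
theorem steerInf_eq_zero [CompleteSpace H] {K : H →L[ℂ] H} {Φ : W →L[ℂ] H} {C : ℝ} (hC : 0 ≤ C)
    (hKΦ : ∀ y, ∃ w, K y + Φ w = 0 ∧ ‖w‖ ≤ C * ‖y‖)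
    (hcomp : IsCompactOperator K) (hK : spectralRadius ℂ K ≤ 1) (y : H) :
    steerInf K Φ y = 0 := by
  have hcont : Continuous (steerInf K Φ) := by
    refine (LipschitzWith.of_le_add_mul ⟨C, hC⟩ fun x y => ?_).continuous
    have h1 := steerInf_add_le hC hKΦ y (x - y)
    rw [add_sub_cancel] at h1
    refine h1.trans ?_
    gcongr
    rw [dist_eq_norm]
    exact steerInf_le_mul_norm hC hKΦ _
  -- Requiring zero cost along the whole free orbit, rather than at `x` alone, makes the subspace
  -- `K`-invariant.
  let N : Submodule ℂ H :=
    { carrier := {x | ∀ j : ℕ, steerInf K Φ ((K ^ j) x) = 0}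
      add_mem' := fun {a b} ha hb j => by
        refine le_antisymm ?_ (steerInf_nonneg _)
        rw [map_add]
        exact (steerInf_add_le hC hKΦ _ _).trans_eq (by rw [ha j, hb j, add_zero])
      zero_mem' := fun j => by
        refine le_antisymm ?_ (steerInf_nonneg _)
        simpa using steerInf_le_mul_norm hC hKΦ (0 : H)
      smul_mem' := fun c x hx j => by
        refine le_antisymm ?_ (steerInf_nonneg _)
        rw [map_smul]
        exact (steerInf_smul_le hC hKΦ _ _).trans_eq (by rw [hx j, mul_zero]) }
  have hmem : ∀ x, x ∈ N ↔ ∀ j : ℕ, steerInf K Φ ((K ^ j) x) = 0 := fun _ => Iff.rfl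
  have hNK : ∀ x ∈ N, K x ∈ N := fun x hx j => by
    have := hx (j + 1)
    rwa [pow_succ, mul_apply_eq_comp] at this
  have hNclosed : IsClosed (N : Set H) := by
    have : (N : Set H) = ⋂ j : ℕ, {x | steerInf K Φ ((K ^ j) x) = 0} := by
      ext x; simp [hmem]
    rw [this]
    exact isClosed_iInter fun j => isClosed_eq (hcont.comp (K ^ j).continuous) continuous_const
  have hN0 : ∀ x ∈ N, steerInf K Φ x = 0 := fun x hx => by simpa using hx 0
  have hshift : ∀ x n, n ∈ N → steerInf K Φ (x + n) ≤ steerInf K Φ x := fun x n hn =>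
    (steerInf_add_le hC hKΦ x n).trans_eq (by rw [hN0 n hn, add_zero])
  have : CompleteSpace N := hNclosed.completeSpace_coe
  -- `Q` is the orthogonal projection onto the complement of `N`, a concrete model of the quotient
  -- map to `H / N`.
  obtain ⟨Q, hQ, hQN, hQle⟩ : ∃ Q : H →L[ℂ] H, (∀ x, x - Q x ∈ N) ∧ (∀ x ∈ N, Q x = 0) ∧
      ∀ x, ‖Q x‖ ≤ ‖x‖ := by
    refine ⟨Nᗮ.starProjection, fun x => ?_, fun x hx => ?_,
      fun x => Submodule.norm_starProjection_apply_le _ _⟩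
    · have h := Nᗮ.sub_starProjection_mem_orthogonal x
      rwa [N.orthogonal_orthogonal] at h
    · refine (Submodule.starProjection_apply_eq_zero_iff _).2 ?_
      rwa [N.orthogonal_orthogonal]
  obtain ⟨T, hT⟩ : ∃ T, T = Q.comp K := ⟨_, rfl⟩
  have hTapp : ∀ x, T x = Q (K x) := fun x => by rw [hT, ContinuousLinearMap.comp_apply]
  have hTcomp : IsCompactOperator T := hT ▸ hcomp.clm_comp Q
  -- Invariance of `N` gives `Q K Q = Q K`, so the powers of `Q K` collapse.
  have hTpow : ∀ (n : ℕ) x, (T ^ (n + 1)) x = Q ((K ^ (n + 1)) x) := by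
    intro n
    induction n with
    | zero => intro x; simp [hTapp]
    | succ n ih =>
      intro x
      rw [pow_succ' T, mul_apply_eq_comp, ih, hTapp, pow_succ' K (n + 1), mul_apply_eq_comp]
      have h1 := hNK _ (hQ ((K ^ (n + 1)) x))
      have h2 := hQN _ h1
      rw [map_sub, map_sub, sub_eq_zero] at h2
      exact h2.symm
  -- The cost grows along the free evolution and is insensitive to components in `N`.
  have hle : ∀ n : ℕ, steerInf K Φ y ≤ C * ‖(T ^ (n + 1)) y‖ := fun n => by
    refine (steerInf_le_steerInf_pow hC hKΦ (n + 1) y).trans ?_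
    have h1 := hshift (Q ((K ^ (n + 1)) y)) _ (hQ ((K ^ (n + 1)) y))
    rw [add_sub_cancel] at h1
    rw [hTpow]
    exact h1.trans (steerInf_le_mul_norm hC hKΦ _)
  have hspec : spectralRadius ℂ T = 0 := by
    refine le_antisymm (iSup₂_le fun z hz => ?_) bot_le
    by_contra hz0
    have hz0 : z ≠ 0 := by rintro rfl; simp at hz0
    have heig := (hTcomp.hasEigenvalue_iff_mem_spectrum hz0).2 hz
    obtain ⟨v, hv⟩ := heig.exists_hasEigenvector
    have hTv : T v = z • v := hv.apply_eq_smul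
    have hTv' : ∀ n : ℕ, (T ^ n) v = z ^ n • v := by
      intro n
      induction n with
      | zero => simp
      | succ n ih =>
        rw [pow_succ', mul_apply_eq_comp, ih, map_smul, hTv, smul_smul, pow_succ]
    have hv0 : 0 < ‖v‖ := norm_pos_iff.2 hv.2
    -- The spectral radius of the compression is not compared with that of `K` directly: `z ^ n v =
    -- Q (K ^ n v)` gives `|z| ^ n ≤ ‖K ^ n‖`, and Gelfand's formula for `K` concludes.
    have hz1 : ‖z‖₊ ≤ 1 := by
      refine norm_le_one_of_pow_le hK fun n hn => ?_
      obtain ⟨m, rfl⟩ := Nat.exists_eq_succ_of_ne_zero hn.ne'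
      have h1 : ‖z ^ (m + 1) • v‖ ≤ ‖K ^ (m + 1)‖ * ‖v‖ := by
        rw [← hTv', hTpow]
        exact (hQle _).trans ((K ^ (m + 1)).le_opNorm v)
      rw [norm_smul, norm_pow] at h1
      exact_mod_cast le_of_mul_le_mul_right h1 hv0
    have hn : K v - z • v ∈ N := by
      have := hQ (K v)
      rwa [← hTapp, hTv] at this
    have hpow : ∀ j : ℕ, (K ^ j) v - z ^ j • v ∈ N := by
      intro j
      induction j with
      | zero => simp
      | succ j ih =>
        have h1 := N.add_mem (hNK _ ih) (N.smul_mem (z ^ j) hn)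
        convert h1 using 1
        rw [pow_succ' K, mul_apply_eq_comp, map_sub, map_smul, smul_sub, smul_smul,
          pow_succ]
        abel
    have hpj : ∀ j : ℕ, steerInf K Φ ((K ^ j) v) ≤ steerInf K Φ v := by
      intro j
      have h1 := hshift (z ^ j • v) _ (hpow j)
      rw [add_sub_cancel] at h1
      refine h1.trans ((steerInf_smul_le hC hKΦ _ _).trans ?_)
      rw [norm_pow]
      refine mul_le_of_le_one_left (steerInf_nonneg _) (pow_le_one₀ (norm_nonneg _) ?_)
      exact_mod_cast hz1
    -- Modulo `N`, `K` acts on `v` as multiplication by `z`, and `|z| ≤ 1`, so the cost of `K v`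
    -- does not exceed that of `v`.
    have hpv : steerInf K Φ v = 0 :=
      steerInf_eq_zero_of_map_le hC hKΦ (by simpa using hpj 1)
    have hvN : v ∈ N := fun j => le_antisymm ((hpj j).trans_eq hpv) (steerInf_nonneg _)
    have hTv0 : T v = 0 := (hTapp v).trans (hQN _ (hNK _ hvN))
    rw [hTv] at hTv0
    exact (smul_ne_zero hz0 hv.2) hTv0
  have hlim : Tendsto (fun n : ℕ => C * ‖(T ^ (n + 1)) y‖) atTop (𝓝 (C * ‖(0 : H)‖)) :=
    (((tendsto_pow_apply_of_spectralRadius_eq_zero hspec y).comp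
      (tendsto_add_atTop_nat 1)).norm).const_mul C
  rw [norm_zero, mul_zero] at hlim
  exact le_antisymm (ge_of_tendsto' hlim hle) (steerInf_nonneg _)

end Discrete

/-! ### Compact operators on Hilbert spaces -/

section Compact

variable {H : Type*} [NormedAddCommGroup H] [InnerProductSpace ℂ H] [CompleteSpace H]

/-- The inequality `‖T* x‖² ≤ ‖x‖ ‖T T* x‖` turns a finite net for the image of the ball under the
compact operator `T T*` into one for its image under `T*`. -/
theorem IsCompactOperator.adjoint {T : H →L[ℂ] H} (hT : IsCompactOperator T) :
    IsCompactOperator T.adjoint := by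
  have hTT : IsCompactOperator (T.comp T.adjoint) := hT.comp_clm T.adjoint
  obtain ⟨C, hC, hsub⟩ := IsCompactOperator.image_closedBall_subset_compact
    (f := ((T.comp T.adjoint : H →L[ℂ] H) : H →ₗ[ℂ] H)) hTT 1
  have htb := hC.totallyBounded.subset hsub
  refine (isCompactOperator_iff_image_closedBall_subset_compact
    ((T.adjoint : H →L[ℂ] H) : H →ₗ[ℂ] H) one_pos).2
    ⟨closure (T.adjoint '' Metric.closedBall 0 1), ?_, subset_closure⟩
  refine TotallyBounded.isCompact_of_isClosed (TotallyBounded.closure ?_) isClosed_closure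
  refine Metric.totallyBounded_iff.2 fun ε hε => ?_
  -- Two points of the unit ball differ by at most `2` in norm, so a net of mesh `ε ^ 2 / 2` for `T
  -- T*` gives mesh `ε` for `T*`.
  obtain ⟨t, hts, htf, hcov⟩ := Metric.finite_approx_of_totallyBounded htb (ε ^ 2 / 2)
    (by positivity)
  choose! g hg using fun y (hy : y ∈ t) => hts hy
  refine ⟨(fun y => T.adjoint (g y)) '' t, htf.image _, ?_⟩
  rintro _ ⟨x, hx, rfl⟩
  obtain ⟨y, hy, hxy⟩ := mem_iUnion₂.1 (hcov (mem_image_of_mem _ hx))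
  refine mem_iUnion₂.2 ⟨_, mem_image_of_mem _ hy, ?_⟩
  obtain ⟨hgy, hgy'⟩ := hg y hy
  rw [Metric.mem_ball, ← hgy', dist_eq_norm, ← map_sub] at hxy
  rw [Metric.mem_ball, dist_eq_norm, ← map_sub]
  have h1 : ‖T.adjoint (x - g y)‖ ^ 2 ≤ ‖x - g y‖ * ‖T (T.adjoint (x - g y))‖ := by
    rw [← inner_self_eq_norm_sq (𝕜 := ℂ), ContinuousLinearMap.adjoint_inner_left]
    exact (RCLike.re_le_norm _).trans (norm_inner_le_norm _ _)
  have h2 : ‖x - g y‖ ≤ 2 := by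
    have h3 := norm_sub_le x (g y)
    rw [mem_closedBall_zero_iff] at hx hgy
    linarith
  have h3 : ‖T (T.adjoint (x - g y))‖ < ε ^ 2 / 2 := hxy
  have h4 : ‖T.adjoint (x - g y)‖ ^ 2 < ε ^ 2 := by
    nlinarith [norm_nonneg (T (T.adjoint (x - g y)))]
  exact lt_of_pow_lt_pow_left₀ 2 hε.le h4

end Compact

/-! ### Exponential integrals of orbits, and spectral inclusion -/

namespace C0Semigroup

variable {H : Type*} [NormedAddCommGroup H] [InnerProductSpace ℂ H] (S : C0Semigroup H)

theorem zero_apply (x : H) : S 0 x = x := by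
  rw [show S 0 = _ from S.map_zero']; rfl

theorem add_apply (s t : ℝ≥0) (x : H) : S (s + t) x = S s (S t x) := by
  rw [show S (s + t) = _ from S.map_add' s t]; rfl

theorem comm_apply (s t : ℝ≥0) (x : H) : S s (S t x) = S t (S s x) := by
  rw [← add_apply, ← add_apply, add_comm]

theorem continuous_orbit (x : H) : Continuous fun t => S t x := S.continuous_orbit' x

variable {S} in
theorem HasGenerator.generator_eq {x y : H} (h : S.HasGenerator x y)
    (hx : x ∈ S.generator.domain) : S.generator ⟨x, hx⟩ = y :=
  tendsto_nhds_unique (S.hasGenerator_generator ⟨x, hx⟩) h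

theorem continuous_exp_smul (μ : ℂ) (x : H) :
    Continuous fun s : ℝ => Complex.exp (-μ * s) • S s.toNNReal x :=
  (by fun_prop : Continuous fun s : ℝ => Complex.exp (-μ * s)).smul
    ((S.continuous_orbit x).comp continuous_real_toNNReal)

section Complete

variable [CompleteSpace H]

/-- The semigroup is bounded on bounded time intervals. -/
theorem exists_norm_le (T : ℝ≥0) : ∃ M : ℝ, 0 ≤ M ∧ ∀ t ≤ T, ‖S t‖ ≤ M := by
  obtain ⟨C, hC⟩ := banach_steinhaus (g := fun t : Icc (0 : ℝ≥0) T => S t) (fun x => by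
    obtain ⟨C, hC⟩ := isCompact_Icc.exists_bound_of_continuousOn
      (S.continuous_orbit x).continuousOn (s := Icc (0 : ℝ≥0) T)
    exact ⟨C, fun t => hC t t.2⟩)
  exact ⟨C, (norm_nonneg _).trans (hC ⟨0, by simp⟩), fun t ht => hC ⟨t, by simpa using ht⟩⟩

/-- The integral `∫_0^t e^{-μ s} S(s) x ds`. -/
noncomputable def expIntegral (μ : ℂ) (t : ℝ) (x : H) : H :=
  ∫ s in (0 : ℝ)..t, Complex.exp (-μ * s) • S s.toNNReal x

omit [CompleteSpace H] in
theorem intervalIntegrable_exp_smul (μ : ℂ) (x : H) (a b : ℝ) :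
    IntervalIntegrable (fun s : ℝ => Complex.exp (-μ * s) • S s.toNNReal x) volume a b :=
  (S.continuous_exp_smul μ x).intervalIntegrable a b

theorem map_expIntegral (μ : ℂ) (t : ℝ) (h : ℝ≥0) (x : H) :
    S h (S.expIntegral μ t x) = S.expIntegral μ t (S h x) := by
  rw [expIntegral, expIntegral, ← ContinuousLinearMap.intervalIntegral_comp_comm _
    (S.intervalIntegrable_exp_smul μ x 0 t)]
  refine intervalIntegral.integral_congr fun s _ => ?_
  simp only [map_smul, S.comm_apply h]

theorem exp_smul_map_expIntegral (μ : ℂ) {t : ℝ} (ht : 0 ≤ t) (h : ℝ≥0) (x : H) :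
    Complex.exp (-μ * h) • S h (S.expIntegral μ t x) =
      ∫ s in (h : ℝ)..(t + h), Complex.exp (-μ * s) • S s.toNNReal x := by
  rw [expIntegral, ← ContinuousLinearMap.intervalIntegral_comp_comm _
    (S.intervalIntegrable_exp_smul μ x 0 t), ← intervalIntegral.integral_smul]
  have := intervalIntegral.integral_comp_add_right (a := 0) (b := t)
    (fun s : ℝ => Complex.exp (-μ * s) • S s.toNNReal x) (h : ℝ)
  rw [zero_add] at this
  rw [← this]
  refine intervalIntegral.integral_congr fun s hs => ?_
  rw [uIcc_of_le ht] at hs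
  simp only [map_smul, smul_smul, ← Complex.exp_add]
  have h1 : (s + h).toNNReal = h + s.toNNReal := by
    rw [Real.toNNReal_add hs.1 h.coe_nonneg, Real.toNNReal_coe, add_comm]
  rw [h1, S.add_apply]
  congr 2
  push_cast
  ring

/-- The shifted and original intervals overlap, leaving only the two end pieces of length `h`, which
are then differentiated at `h = 0`. -/
theorem exp_smul_map_expIntegral_sub (μ : ℂ) {t : ℝ} (ht : 0 ≤ t) (h : ℝ≥0) (x : H) :
    Complex.exp (-μ * h) • S h (S.expIntegral μ t x) - S.expIntegral μ t x =
      (∫ s in t..(t + h), Complex.exp (-μ * s) • S s.toNNReal x) -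
        ∫ s in (0 : ℝ)..h, Complex.exp (-μ * s) • S s.toNNReal x := by
  rw [S.exp_smul_map_expIntegral μ ht, expIntegral]
  have hi := S.intervalIntegrable_exp_smul μ x
  rw [← intervalIntegral.integral_add_adjacent_intervals (hi h t) (hi t (t + h)),
    ← intervalIntegral.integral_add_adjacent_intervals (hi 0 h) (hi h t)]
  abel

theorem tendsto_coe_nhdsGT_zero : Tendsto (fun h : ℝ≥0 => (h : ℝ)) (𝓝[>] 0) (𝓝[>] 0) := by
  refine tendsto_nhdsWithin_iff.2 ⟨?_, ?_⟩
  · exact (NNReal.continuous_coe.tendsto 0).mono_left nhdsWithin_le_nhds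
  · filter_upwards [self_mem_nhdsWithin] with h hh
    exact NNReal.coe_pos.2 hh

theorem tendsto_inv_smul_integral {f : ℝ → H} (hf : Continuous f) (a : ℝ) :
    Tendsto (fun h : ℝ≥0 => (h : ℝ)⁻¹ • ∫ s in a..(a + h), f s) (𝓝[>] 0) (𝓝 (f a)) := by
  have h1 : HasDerivAt (fun u => ∫ s in a..u, f s) (f a) a :=
    intervalIntegral.integral_hasDerivAt_right (hf.intervalIntegrable _ _)
      (hf.stronglyMeasurableAtFilter _ _) hf.continuousAt
  have h2 := (h1.tendsto_slope_zero_right).comp tendsto_coe_nhdsGT_zero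
  refine h2.congr fun h => ?_
  simp

/-- The vector `z = ∫_0^t e^{-μ s} S(s) x ds` lies in the domain of the generator, and
`(A - μ) z = e^{-μ t} S(t) x - x`. -/
theorem hasGenerator_expIntegral (μ : ℂ) (t : ℝ≥0) (x : H) :
    S.HasGenerator (S.expIntegral μ t x)
      (μ • S.expIntegral μ t x + (Complex.exp (-μ * t) • S t x - x)) := by
  set z := S.expIntegral μ t x with hz
  have hi := S.continuous_exp_smul μ x
  have h1 : Tendsto (fun h : ℝ≥0 => (h : ℝ)⁻¹ • (Complex.exp (-μ * h) • S h z - z)) (𝓝[>] 0)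
      (𝓝 (Complex.exp (-μ * t) • S t x - x)) := by
    have h2 := (tendsto_inv_smul_integral hi t).sub (tendsto_inv_smul_integral hi 0)
    simp only [Real.toNNReal_coe, Complex.ofReal_zero, mul_zero, Complex.exp_zero,
      Real.toNNReal_zero, S.zero_apply, one_smul, zero_add] at h2
    refine h2.congr fun h => ?_
    rw [hz, S.exp_smul_map_expIntegral_sub μ t.coe_nonneg, smul_sub]
  have h3 : HasDerivAt (fun h : ℝ => Complex.exp (μ * h)) μ 0 := by
    have := ((Complex.ofRealCLM.hasDerivAt (x := 0)).const_mul μ).cexp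
    simpa using this
  have h4 : Tendsto (fun h : ℝ≥0 => (h : ℝ)⁻¹ • (Complex.exp (μ * h) - 1)) (𝓝[>] 0) (𝓝 μ) := by
    refine ((h3.tendsto_slope_zero_right).comp tendsto_coe_nhdsGT_zero).congr fun h => ?_
    simp
  have h5 : Tendsto (fun h : ℝ≥0 => Complex.exp (μ * (h : ℝ))) (𝓝[>] 0) (𝓝 1) := by
    have : Continuous fun h : ℝ≥0 => Complex.exp (μ * (h : ℝ)) := by fun_prop
    simpa using (this.tendsto 0).mono_left nhdsWithin_le_nhds
  -- Uses `S h z - z = (e^{μh} - 1) z + e^{μh} (e^{-μh} S h z - z)`.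
  have h6 := (h4.smul_const z).add (h5.smul h1)
  rw [one_smul] at h6
  refine h6.congr fun h => ?_
  have h7 : Complex.exp (μ * (h : ℝ)) * Complex.exp (-μ * (h : ℝ)) = 1 := by
    rw [← Complex.exp_add]; simp
  rw [smul_comm (Complex.exp _), smul_assoc, ← smul_add, smul_sub, smul_smul, h7, sub_smul,
    one_smul, one_smul]
  congr 1
  abel

theorem expIntegral_mem_domain (μ : ℂ) (t : ℝ≥0) (x : H) :
    S.expIntegral μ t x ∈ S.generator.domain :=
  ⟨_, S.hasGenerator_expIntegral μ t x⟩

/-- The averages `t⁻¹ ∫_0^t S(s) x ds` lie in the domain and tend to `x`. -/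
theorem dense_domain : Dense (S.generator.domain : Set H) := fun x => by
  have h := tendsto_inv_smul_integral (S.continuous_exp_smul 0 x) 0
  simp only [Real.toNNReal_zero, S.zero_apply, neg_zero, zero_mul, Complex.exp_zero, one_smul,
    zero_add] at h
  refine mem_closure_of_tendsto h (Eventually.of_forall fun t => ?_)
  have h1 := S.expIntegral_mem_domain 0 t x
  simp only [expIntegral, neg_zero, zero_mul, Complex.exp_zero, one_smul] at h1
  exact S.generator.domain.smul_of_tower_mem (t : ℝ)⁻¹ h1

/-- `x ↦ ∫_0^t e^{-μ s} S(s) x ds` as a bounded operator. -/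
noncomputable def expIntegralL (μ : ℂ) (t : ℝ≥0) : H →L[ℂ] H :=
  LinearMap.mkContinuousOfExistsBound
    { toFun := S.expIntegral μ t
      map_add' := fun x y => by
        simp only [expIntegral, map_add, smul_add]
        exact intervalIntegral.integral_add (S.intervalIntegrable_exp_smul μ x 0 t)
          (S.intervalIntegrable_exp_smul μ y 0 t)
      map_smul' := fun c x => by
        simp only [expIntegral, map_smul, smul_comm _ c, RingHom.id_apply]
        exact intervalIntegral.integral_smul c _ }
    (by
      obtain ⟨M, hM, hMt⟩ := S.exists_norm_le t
      obtain ⟨E, hE⟩ := isCompact_Icc.exists_bound_of_continuousOn (s := Icc (0 : ℝ) t)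
        (by fun_prop : Continuous fun s : ℝ => Complex.exp (-μ * s)).continuousOn
      refine ⟨E * M * t, fun x => ?_⟩
      have h := intervalIntegral.norm_integral_le_of_norm_le_const (a := 0) (b := (t : ℝ))
        (f := fun s : ℝ => Complex.exp (-μ * s) • S s.toNNReal x) (C := E * M * ‖x‖)
        (fun s hs => by
          rw [uIoc_of_le t.coe_nonneg] at hs
          rw [norm_smul, mul_assoc]
          have h1 := hE s ⟨hs.1.le, hs.2⟩
          have h2 := hMt s.toNNReal (Real.toNNReal_le_iff_le_coe.2 hs.2)
          have h3 := (S s.toNNReal).le_opNorm x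
          gcongr
          · exact (norm_nonneg _).trans h1
          · exact h3.trans (by gcongr))
      rw [sub_zero, abs_of_nonneg t.coe_nonneg] at h
      exact h.trans_eq (by ring))

theorem expIntegralL_apply (μ : ℂ) (t : ℝ≥0) (x : H) :
    S.expIntegralL μ t x = S.expIntegral μ t x := rfl

theorem expIntegral_generator (μ : ℂ) (t : ℝ≥0) {x y : H} (h : S.HasGenerator x y) :
    S.HasGenerator (S.expIntegral μ t x) (S.expIntegral μ t y) := by
  refine (((S.expIntegralL μ t).continuous.tendsto y).comp h).congr fun s => ?_
  change S.expIntegralL μ t _ = _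
  rw [(S.expIntegralL μ t).map_smul_of_tower, map_sub, expIntegralL_apply, expIntegralL_apply,
    S.map_expIntegral]

/-- Spectral inclusion: if `1 - e^{-μ t} S(t)` is invertible then `μ` is in the resolvent set. -/
theorem mem_resolventSet_of_isUnit {μ : ℂ} {t : ℝ≥0}
    (h : IsUnit (1 - Complex.exp (-μ * t) • S t)) : μ ∈ S.resolventSet := by
  obtain ⟨u, hu⟩ := h
  obtain ⟨V, hV⟩ : ∃ V : H →L[ℂ] H, V = ↑u⁻¹ := ⟨_, rfl⟩
  have hVl : ∀ x, V (x - Complex.exp (-μ * t) • S t x) = x := fun x => by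
    have := DFunLike.congr_fun u.inv_mul x
    rw [← hV, hu] at this
    exact this
  have hVr : ∀ x, V x - Complex.exp (-μ * t) • S t (V x) = x := fun x => by
    have := DFunLike.congr_fun u.mul_inv x
    rw [← hV, hu] at this
    exact this
  have key : ∀ x, μ • S.expIntegral μ t x -
      (μ • S.expIntegral μ t x + (Complex.exp (-μ * t) • S t x - x)) =
      x - Complex.exp (-μ * t) • S t x := fun x => by abel
  have hJV : ∀ x, S.expIntegralL μ t (V x) = V (S.expIntegralL μ t x) := fun x => by
    conv_rhs => rw [← hVr x]
    rw [map_sub, map_smul]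
    have : S.expIntegralL μ t (S t (V x)) = S t (S.expIntegralL μ t (V x)) :=
      (S.map_expIntegral μ t t _).symm
    rw [this, hVl]
  -- If `J` is the exponential integral, then `(μ - A) J = 1 - e^{-μt} S(t)`, so `J V` is a right
  -- inverse of `μ - A`. It is also a left inverse, since `J` commutes with `A` on its domain and
  -- with `V`.
  refine ⟨(S.expIntegralL μ t).comp V, fun x => ⟨S.expIntegral_mem_domain μ t (V x), ?_⟩,
    fun x => ?_⟩
  · have h1 := (S.hasGenerator_expIntegral μ t (V x)).generator_eq
      (S.expIntegral_mem_domain μ t (V x))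
    exact (congrArg (fun y => μ • S.expIntegral μ t (V x) - y) h1).trans
      ((key (V x)).trans (hVr x))
  · change S.expIntegralL μ t (V _) = _
    have hx := S.hasGenerator_generator x
    have h1 := (S.expIntegral_generator μ t hx).generator_eq
      (S.expIntegral_mem_domain μ t x)
    rw [(S.hasGenerator_expIntegral μ t x).generator_eq] at h1
    rw [hJV, map_sub, map_smul, expIntegralL_apply, expIntegralL_apply, ← h1, key, hVl]

end Complete

end C0Semigroup

/-! ### Spectral bound of the generator and eigenvalues of the semigroup operators -/

/-- A continuous function on a compact interval whose Fourier coefficients all vanish is zero. -/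
theorem eq_zero_of_forall_fourierCoeffOn_eq_zero {a b : ℝ} (hab : a < b) {f : ℝ → ℂ}
    (hf : Continuous f) (h : ∀ n, fourierCoeffOn hab f n = 0) {x : ℝ} (hx : x ∈ Icc a b) :
    f x = 0 := by
  by_contra hfx
  obtain ⟨C, hC⟩ := isCompact_Icc.exists_bound_of_continuousOn (s := Icc a b) hf.continuousOn
  -- By Parseval, the integral of `‖f‖²` would vanish, although it is positive for a continuous `f`
  -- with `f x ≠ 0`.
  have h1 := tsum_sq_fourierCoeffOn hab (f := f) (MemLp.of_bound hf.aestronglyMeasurable C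
    ((ae_restrict_mem measurableSet_Ioc).mono fun y hy => hC y (Ioc_subset_Icc_self hy)))
  simp only [h, norm_zero, ne_eq, OfNat.ofNat_ne_zero, not_false_eq_true, zero_pow, tsum_zero,
    smul_eq_mul] at h1
  have h2 : 0 < ∫ x in a..b, ‖f x‖ ^ 2 :=
    intervalIntegral.integral_pos hab
    (by fun_prop : Continuous fun x => ‖f x‖ ^ 2).continuousOn (fun y _ => by positivity)
    ⟨x, hx, by positivity⟩
  have h3 : 0 < (b - a)⁻¹ := inv_pos.2 (sub_pos.2 hab)
  exact (mul_pos h3 h2).ne h1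

namespace C0Semigroup

variable {H : Type*} [NormedAddCommGroup H] [InnerProductSpace ℂ H] (S : C0Semigroup H)
  [CompleteSpace H]

omit [CompleteSpace H] in
theorem mem_resolventSet_of_spectralBound_lt {z : ℂ} (h : S.spectralBound < z.re) :
    z ∈ S.resolventSet := by
  by_contra hz
  exact h.not_ge (le_iSup₂_of_le (f := fun (z : ℂ) (_ : z ∈ S.spectrum) => ((z.re : ℝ) : EReal))
    z hz le_rfl)

omit [CompleteSpace H] in
variable {S} in
/-- Eigenvectors of the generator do not exist in the resolvent set. -/
theorem eq_zero_of_hasGenerator_smul {z : ℂ} (hz : z ∈ S.resolventSet) {x : H}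
    (hx : S.HasGenerator x (z • x)) : x = 0 := by
  obtain ⟨R, -, hR⟩ := hz
  have h1 := hR ⟨x, _, hx⟩
  rw [hx.generator_eq ⟨_, hx⟩] at h1
  simpa using h1.symm

/-- If every `z` with `e^{z τ} = w` is in the resolvent set, then `w` is not an eigenvalue of
`S(τ)`. -/
theorem eq_zero_of_map_eq_exp_smul {τ : ℝ≥0} (hτ : 0 < τ) {z : ℂ}
    (hz : ∀ k : ℤ, z + 2 * Real.pi * Complex.I * k / τ ∈ S.resolventSet) {v : H}
    (hv : S τ v = Complex.exp (z * τ) • v) : v = 0 := by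
  have hτ' : (τ : ℂ) ≠ 0 := by exact_mod_cast hτ.ne'
  have hτr : (0 : ℝ) < τ := hτ
  -- For `μ = z + 2πik/τ` the boundary term `e^{-μτ} S(τ) v - v` vanishes, so the integral would be
  -- an eigenvector of `A` for `μ`.
  have hzero : ∀ k : ℤ, S.expIntegral (z + 2 * Real.pi * Complex.I * k / τ) τ v = 0 := fun k => by
    refine eq_zero_of_hasGenerator_smul (hz k) ?_
    have h1 := S.hasGenerator_expIntegral (z + 2 * Real.pi * Complex.I * k / τ) τ v
    have h2 : Complex.exp (-(z + 2 * Real.pi * Complex.I * k / τ) * τ) *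
        Complex.exp (z * τ) = 1 := by
      rw [← Complex.exp_add, ← Complex.exp_int_mul_two_pi_mul_I (-k)]
      congr 1
      push_cast
      field_simp
      ring
    have h3 : ((τ : ℝ) : ℂ) = (τ : ℂ) := rfl
    rwa [hv, smul_smul, h3, h2, one_smul, sub_self, add_zero] at h1
  have hg : Continuous fun s : ℝ => inner ℂ v (Complex.exp (-z * s) • S s.toNNReal v) :=
    (innerSL ℂ v).continuous.comp (S.continuous_exp_smul z v)
  -- The Fourier coefficients of `s ↦ ⟪v, e^{-zs} S(s) v⟫` are multiples of the pairings of `v` with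
  -- these integrals. The value of this function at `s = 0` is `‖v‖²`.
  have h0 := eq_zero_of_forall_fourierCoeffOn_eq_zero hτr hg (fun n => by
    rw [fourierCoeffOn_eq_integral]
    have h1 : (∫ s in (0 : ℝ)..τ, fourier (-n) (s : AddCircle ((τ : ℝ) - 0)) •
        inner ℂ v (Complex.exp (-z * s) • S s.toNNReal v)) =
        inner ℂ v (S.expIntegral (z + 2 * Real.pi * Complex.I * n / τ) τ v) := by
      have h2 := ContinuousLinearMap.intervalIntegral_comp_comm (innerSL ℂ v)
        (S.intervalIntegrable_exp_smul (z + 2 * Real.pi * Complex.I * n / τ) v 0 τ)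
      simp only [innerSL_apply_apply] at h2
      rw [expIntegral, ← h2]
      refine intervalIntegral.integral_congr fun s _ => ?_
      simp only [fourier_coe_apply, inner_smul_right, smul_eq_mul, ← mul_assoc, ← Complex.exp_add]
      congr 2
      push_cast
      rw [sub_zero]
      have h3 : ((τ : ℝ) : ℂ) = (τ : ℂ) := rfl
      rw [h3]
      field_simp
      ring
    rw [h1, hzero, inner_zero_right, smul_zero]) (left_mem_Icc.2 hτr.le)
  simpa [S.zero_apply] using h0

/-- A spectral value `w` with `|w| > 1` is an eigenvalue by compactness, while all logarithms of `w`
divided by `τ` have real part `log |w| / τ > 0` and so lie in the resolvent set. -/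
theorem spectralRadius_le_one (hs : S.spectralBound ≤ 0) {τ : ℝ≥0} (hτ : 0 < τ)
    (hcomp : IsCompactOperator (S τ)) : spectralRadius ℂ (S τ) ≤ 1 := by
  refine iSup₂_le fun w hw => ?_
  by_contra hw1
  rw [not_le] at hw1
  have hw1 : 1 < ‖w‖ := by exact_mod_cast hw1
  have hw0 : w ≠ 0 := by rintro rfl; norm_num at hw1
  obtain ⟨v, hv⟩ := ((hcomp.hasEigenvalue_iff_mem_spectrum hw0).2 hw).exists_hasEigenvector
  have hτr : (0 : ℝ) < τ := hτ
  have hτ' : (τ : ℂ) ≠ 0 := by exact_mod_cast hτ.ne'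
  refine hv.2 (S.eq_zero_of_map_eq_exp_smul hτ (z := Complex.log w / τ) (fun k => ?_) ?_)
  · refine S.mem_resolventSet_of_spectralBound_lt (hs.trans_lt ?_)
    have h1 : (Complex.log w / τ + 2 * Real.pi * Complex.I * k / τ).re = Real.log ‖w‖ / τ := by
      have h2 : Complex.log w / τ + 2 * Real.pi * Complex.I * k / τ =
          (Complex.log w + 2 * Real.pi * Complex.I * k) / (τ : ℝ) := by
        rw [← add_div]
      rw [h2, Complex.div_ofReal_re]
      simp [Complex.log_re]
    rw [h1]
    exact_mod_cast div_pos (Real.log_pos hw1) hτr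
  · rw [div_mul_cancel₀ _ hτ', Complex.exp_log hw0]
    exact hv.apply_eq_smul

theorem exists_mem_resolventSet : ∃ z, z ∈ S.resolventSet := by
  -- The choice makes `‖e^{-z} S(1)‖ < 1`, so a Neumann series applies.
  refine ⟨(Real.log (‖S 1‖ + 2) : ℝ), S.mem_resolventSet_of_isUnit (t := 1) ?_⟩
  refine isUnit_one_sub_of_norm_lt_one ?_
  have h1 : 0 < ‖S 1‖ + 2 := by positivity
  rw [norm_smul, Complex.norm_exp]
  simp only [Complex.neg_re, Complex.ofReal_re, NNReal.coe_one, Complex.ofReal_one, mul_one]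
  rw [Real.exp_neg, Real.exp_log h1, inv_mul_lt_iff₀ h1]
  linarith

/-- If `s(A) > 0` then some `S(τ)*` has an eigenvalue outside the closed unit disc. -/
theorem exists_adjoint_eigenvector (hs : 0 < S.spectralBound) (hS : S.EventuallyCompact) :
    ∃ τ : ℝ≥0, 0 < τ ∧ ∃ ω : ℂ, 1 < ‖ω‖ ∧ ∃ v : H, v ≠ 0 ∧ (S τ).adjoint v = ω • v := by
  obtain ⟨τ, hτ, hcomp⟩ := hS
  have hτr : (0 : ℝ) < τ := hτ
  obtain ⟨z, hz, hz0⟩ : ∃ z ∈ S.spectrum, 0 < z.re := by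
    by_contra! h
    exact hs.not_ge (iSup₂_le fun z hz => by exact_mod_cast h z hz)
  have hspec : Complex.exp (z * τ) ∈ _root_.spectrum ℂ (S τ) := by
    by_contra hn
    rw [spectrum.notMem_iff] at hn
    refine hz (S.mem_resolventSet_of_isUnit (t := τ) ?_)
    have h1 := (IsUnit.mk0 (Complex.exp (-z * τ)) (Complex.exp_ne_zero _)).map
      (algebraMap ℂ (H →L[ℂ] H)) |>.mul hn
    convert h1 using 1
    rw [mul_sub, ← map_mul, ← Complex.exp_add, Algebra.algebraMap_eq_smul_one,
      Algebra.algebraMap_eq_smul_one, smul_mul_assoc, one_mul]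
    simp
  -- The eigenvalue is sought for the adjoint, since an eigenvector of `S(τ)*` gives a functional
  -- that follows one unstable mode.
  have hspec' : star (Complex.exp (z * τ)) ∈ _root_.spectrum ℂ (star (S τ)) := by
    rw [spectrum.map_star]
    exact Set.star_mem_star.2 hspec
  have hne : star (Complex.exp (z * τ)) ≠ 0 := star_ne_zero.2 (Complex.exp_ne_zero _)
  obtain ⟨v, hv⟩ := (((hcomp τ le_rfl).adjoint.hasEigenvalue_iff_mem_spectrum hne).2
    hspec').exists_hasEigenvector
  refine ⟨τ, hτ, _, ?_, v, hv.2, hv.apply_eq_smul⟩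
  have h3 : z * (τ : ℂ) = z * ((τ : ℝ) : ℂ) := rfl
  rw [norm_star, Complex.norm_exp, h3, Complex.re_mul_ofReal]
  exact Real.one_lt_exp_iff.2 (by positivity)

end C0Semigroup

/-! ### The extrapolation space and its semigroup -/

/-- A locally bounded family of bounded operators, strongly continuous on a dense set, is jointly
continuous. -/
theorem continuous_uncurry_of_dense {E F : Type*} [NormedAddCommGroup E] [NormedSpace ℂ E]
    [NormedAddCommGroup F] [NormedSpace ℂ F] {D : Set E} (hD : Dense D) (T : ℝ≥0 → E →L[ℂ] F)
    (hT : ∀ a, ∃ M : ℝ, ∀ t ≤ a, ‖T t‖ ≤ M) (hc : ∀ x ∈ D, Continuous fun t => T t x) :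
    Continuous fun p : ℝ≥0 × E => T p.1 p.2 := by
  refine continuous_iff_continuousAt.2 fun ⟨t₀, x₀⟩ => ?_
  obtain ⟨M, hM⟩ := hT (t₀ + 1)
  have hM0 : 0 ≤ M := (norm_nonneg _).trans (hM 0 zero_le)
  refine Metric.tendsto_nhds.2 fun ε hε => ?_
  -- The error splits into four terms of size at most `ε / 4`, three of them bounded through `M`; `M
  -- + 1` avoids dividing by zero.
  obtain ⟨y, hy, hyD⟩ := Metric.mem_closure_iff.1 (hD x₀) (ε / (4 * (M + 1))) (by positivity)
  rw [dist_comm, dist_eq_norm] at hyD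
  have h1 : ∀ᶠ p : ℝ≥0 × E in 𝓝 (t₀, x₀), p.1 < t₀ + 1 :=
    continuousAt_fst.eventually_lt_const (by simp)
  have h2 : ∀ᶠ p : ℝ≥0 × E in 𝓝 (t₀, x₀), dist (T p.1 y) (T t₀ y) < ε / 4 :=
    Metric.tendsto_nhds.1 (((hc y hy).comp continuous_fst).tendsto (t₀, x₀)) _ (by positivity)
  have h3 : ∀ᶠ p : ℝ≥0 × E in 𝓝 (t₀, x₀), dist p.2 x₀ < ε / (4 * (M + 1)) :=
    Metric.tendsto_nhds.1 (continuous_snd.tendsto (t₀, x₀)) _ (by positivity)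
  have h4 : M * (ε / (4 * (M + 1))) ≤ ε / 4 := by
    rw [mul_div_assoc', div_le_div_iff₀ (by positivity) (by positivity)]
    nlinarith
  filter_upwards [h1, h2, h3] with p hp1 hp2 hp3
  rw [dist_eq_norm] at hp2 hp3 ⊢
  have e : T p.1 p.2 - T t₀ x₀ = T p.1 (p.2 - x₀) - T p.1 (y - x₀) + (T p.1 y - T t₀ y) +
      T t₀ (y - x₀) := by
    simp only [map_sub]; abel
  have b : ∀ t ≤ t₀ + 1, ∀ z : E, ‖z‖ < ε / (4 * (M + 1)) → ‖T t z‖ ≤ ε / 4 :=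
    fun t ht z hz => ((T t).le_opNorm z).trans
      ((mul_le_mul (hM t ht) hz.le (norm_nonneg _) hM0).trans h4)
  have b1 := b p.1 hp1.le _ hp3
  have b2 := b p.1 hp1.le _ hyD
  have b3 := b t₀ (by simp) _ hyD
  rw [e]
  calc _ ≤ ‖T p.1 (p.2 - x₀)‖ + ‖T p.1 (y - x₀)‖ + ‖T p.1 y - T t₀ y‖ + ‖T t₀ (y - x₀)‖ :=
        (norm_add_le _ _).trans (by
          gcongr
          exact (norm_add_le _ _).trans (by gcongr; exact norm_sub_le _ _))
    _ < ε := by linarith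

namespace C0Semigroup

variable {H : Type*} [NormedAddCommGroup H] [InnerProductSpace ℂ H] (S : C0Semigroup H)
  [CompleteSpace H]

/-- Density of `dom A` makes `generator.adjoint` the true adjoint. As a family of closed conditions
on the pair, this form yields completeness of `dom A*`. -/
theorem mem_domAdjoint_iff (p : WithLp 2 (H × H)) : p ∈ S.DomAdjoint ↔
    ∀ x y, S.HasGenerator x y → inner ℂ p.fst y = inner ℂ p.snd x := by
  constructor
  · intro hp x y hxy
    obtain ⟨v, hv₁, hv₂⟩ := (LinearPMap.mem_graph_iff _).1 hp
    have h1 := LinearPMap.adjoint_isFormalAdjoint S.dense_domain v ⟨x, y, hxy⟩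
    rw [hxy.generator_eq ⟨y, hxy⟩, hv₂] at h1
    change (v : H) = p.fst at hv₁
    rw [← hv₁]
    exact h1.symm
  · intro h
    have hx : ∀ x : S.generator.domain, inner ℂ p.snd (x : H) = inner ℂ p.fst (S.generator x) :=
      fun x => (h x _ (S.hasGenerator_generator x)).symm
    have hmem : p.fst ∈ S.generator.adjoint.domain :=
      S.generator.mem_adjoint_domain_of_exists _ ⟨p.snd, hx⟩
    exact (LinearPMap.mem_graph_iff _).2
      ⟨⟨p.fst, hmem⟩, rfl, LinearPMap.adjoint_apply_eq S.dense_domain _ hx⟩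

theorem isClosed_domAdjoint : IsClosed (S.DomAdjoint : Set (WithLp 2 (H × H))) := by
  have : (S.DomAdjoint : Set (WithLp 2 (H × H))) = ⋂ x, ⋂ y, ⋂ (_ : S.HasGenerator x y),
      {p | inner ℂ p.fst y = inner ℂ p.snd x} := by
    ext p; simp [mem_domAdjoint_iff]
  rw [this]
  refine isClosed_iInter fun x => isClosed_iInter fun y => isClosed_iInter fun _ => ?_
  have h1 : Continuous fun p : WithLp 2 (H × H) => p.fst := (WithLp.fstL 2 ℂ H H).continuous
  have h2 : Continuous fun p : WithLp 2 (H × H) => p.snd := (WithLp.sndL 2 ℂ H H).continuous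
  exact isClosed_eq (h1.inner continuous_const) (h2.inner continuous_const)

instance : CompleteSpace S.DomAdjoint := S.isClosed_domAdjoint.completeSpace_coe

theorem inclDomAdjoint_injective : Function.Injective S.inclDomAdjoint := by
  refine (injective_iff_map_eq_zero _).2 fun v hv => ?_
  have h1 : (v : WithLp 2 (H × H)).fst = 0 := hv
  have h2 : (v : WithLp 2 (H × H)).snd = 0 := by
    refine S.dense_domain.eq_zero_of_inner_left ℂ fun x hx => ?_
    have := (S.mem_domAdjoint_iff v).1 v.2 x _ (S.hasGenerator_generator ⟨x, hx⟩)
    rw [h1, inner_zero_left] at this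
    exact this.symm
  refine Subtype.ext (WithLp.ofLp_injective 2 (Prod.ext h1 h2))

theorem norm_adjointOnDom_le (t : ℝ≥0) : ‖S.adjointOnDom t‖ ≤ ‖S t‖ := by
  refine ContinuousLinearMap.opNorm_le_bound _ (norm_nonneg _) fun v => ?_
  have h1 : ‖S.adjointOnDom t v‖ ^ 2 = ‖(S t).adjoint (v : WithLp 2 (H × H)).fst‖ ^ 2 +
      ‖(S t).adjoint (v : WithLp 2 (H × H)).snd‖ ^ 2 :=
    WithLp.prod_norm_sq_eq_of_L2 _
  have h2 : ‖v‖ ^ 2 = ‖(v : WithLp 2 (H × H)).fst‖ ^ 2 + ‖(v : WithLp 2 (H × H)).snd‖ ^ 2 :=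
    WithLp.prod_norm_sq_eq_of_L2 _
  have h3 : ∀ x, ‖(S t).adjoint x‖ ^ 2 ≤ (‖S t‖ * ‖x‖) ^ 2 := fun x => by
    gcongr
    refine ((S t).adjoint.le_opNorm x).trans_eq ?_
    rw [LinearIsometryEquiv.norm_map]
  refine (abs_le_of_sq_le_sq' ?_ (by positivity)).2
  rw [h1, mul_pow, h2, mul_add, ← mul_pow, ← mul_pow]
  exact add_le_add (h3 _) (h3 _)

theorem adjointOnDom_add (s t : ℝ≥0) (v : S.DomAdjoint) :
    S.adjointOnDom (s + t) v = S.adjointOnDom s (S.adjointOnDom t v) := by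
  have h : ∀ x, (S (s + t)).adjoint x = (S s).adjoint ((S t).adjoint x) := fun x => by
    rw [show S (s + t) = (S t).comp (S s) by rw [add_comm]; exact S.map_add' t s,
      ContinuousLinearMap.adjoint_comp]
    rfl
  exact Subtype.ext (WithLp.ofLp_injective 2 (Prod.ext (h _) (h _)))

theorem inclDomAdjoint_adjointOnDom (t : ℝ≥0) (v : S.DomAdjoint) :
    S.inclDomAdjoint (S.adjointOnDom t v) = (S t).adjoint (S.inclDomAdjoint v) := rfl

theorem adjointOnDom_zero (v : S.DomAdjoint) : S.adjointOnDom 0 v = v := by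
  refine S.inclDomAdjoint_injective ?_
  have h : S 0 = ContinuousLinearMap.id ℂ H := S.map_zero'
  rw [inclDomAdjoint_adjointOnDom, h, ContinuousLinearMap.adjoint_id]
  rfl

theorem extend_add (s t : ℝ≥0) (f : S.DualDom) : S.extend (s + t) f = S.extend s (S.extend t f) :=
  DFunLike.ext _ _ fun v => congrArg f (by rw [add_comm]; exact S.adjointOnDom_add t s v)

theorem norm_extend_le (t : ℝ≥0) (f : S.DualDom) : ‖S.extend t f‖ ≤ ‖S t‖ * ‖f‖ := by
  refine ContinuousLinearMap.opNorm_le_bound _ (by positivity) fun v => ?_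
  refine (f.le_opNorm _).trans ?_
  rw [mul_comm ‖S t‖, mul_assoc]
  gcongr
  exact (S.adjointOnDom t).le_of_opNorm_le (S.norm_adjointOnDom_le t) v

/-- The extrapolation space `(dom A*)'` with its norm topology. -/
def Extrap : Type _ := S.DualDom

noncomputable instance : NormedAddCommGroup S.Extrap :=
  inferInstanceAs (NormedAddCommGroup S.DualDom)

noncomputable instance : NormedSpace ℂ S.Extrap := inferInstanceAs (NormedSpace ℂ S.DualDom)

instance : CompleteSpace S.Extrap := inferInstanceAs (CompleteSpace S.DualDom)

/-- The embedding of `H` into the extrapolation space. -/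
noncomputable def embedL : H →L[ℂ] S.Extrap := S.embed

/-- The semigroup on the extrapolation space as a family of bounded operators. -/
noncomputable def extendL (t : ℝ≥0) : S.Extrap →L[ℂ] S.Extrap :=
  LinearMap.mkContinuous
    { toFun := S.extend t
      map_add' := fun _ _ => rfl
      map_smul' := fun _ _ => rfl } ‖S t‖ (S.norm_extend_le t)

theorem norm_extendL_le (t : ℝ≥0) : ‖S.extendL t‖ ≤ ‖S t‖ :=
  LinearMap.mkContinuous_norm_le _ (norm_nonneg _) _

theorem extendL_add (s t : ℝ≥0) (f : S.Extrap) :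
    S.extendL (s + t) f = S.extendL s (S.extendL t f) := S.extend_add s t f

theorem extendL_embedL (t : ℝ≥0) (y : H) : S.extendL t (S.embedL y) = S.embedL (S t y) :=
  S.extend_embed t y

/-- The pairing of the extrapolation space with an element of `dom A*`. -/
noncomputable def evalL (v : S.DomAdjoint) : S.Extrap →L[ℂ] ℂ :=
  LinearMap.mkContinuous
    { toFun := fun f : S.DualDom => f v
      map_add' := fun _ _ => rfl
      map_smul' := fun _ _ => rfl } ‖v‖ fun f : S.DualDom => by
    rw [mul_comm]
    exact f.le_opNorm v

theorem norm_evalL_le (v : S.DomAdjoint) : ‖S.evalL v‖ ≤ ‖v‖ :=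
  LinearMap.mkContinuous_norm_le _ (norm_nonneg _) _

theorem evalL_embedL (v : S.DomAdjoint) (y : H) :
    S.evalL v (S.embedL y) = inner ℂ (S.inclDomAdjoint v) y := rfl

theorem evalL_extendL (v : S.DomAdjoint) (t : ℝ≥0) (f : S.Extrap) :
    S.evalL v (S.extendL t f) = S.evalL (S.adjointOnDom t v) f := rfl

theorem norm_le_of_evalL {f : S.Extrap} {C : ℝ} (hC : 0 ≤ C) (h : ∀ v, ‖S.evalL v f‖ ≤ C * ‖v‖) :
    ‖f‖ ≤ C :=
  ContinuousLinearMap.opNorm_le_bound (f : S.DualDom) hC h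

theorem exists_evalL_eq_inner (f : S.Extrap) :
    ∃ w : S.DomAdjoint, ∀ v, S.evalL v f = inner ℂ v w := by
  let f' : S.DualDom := f
  let g : S.DomAdjoint →L[ℂ] ℂ :=
    { toFun := fun v => starRingEnd ℂ (f' v)
      map_add' := fun v w => by simp
      map_smul' := fun c v => by simp
      cont := RCLike.continuous_conj.comp f'.continuous }
  refine ⟨(InnerProductSpace.toDual ℂ S.DomAdjoint).symm g, fun v => ?_⟩
  have h1 : inner ℂ ((InnerProductSpace.toDual ℂ S.DomAdjoint).symm g) v = starRingEnd ℂ (f' v) :=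
    InnerProductSpace.toDual_symm_apply
  have h2 := inner_conj_symm (𝕜 := ℂ) v ((InnerProductSpace.toDual ℂ S.DomAdjoint).symm g)
  rw [h1, Complex.conj_conj] at h2
  exact h2

/-- After Riesz representation on `dom A*`, the embedding becomes the adjoint of the injective
inclusion `dom A* → H`, whose range is dense. Strong continuity of the extended semigroup then
follows from that on `H`. -/
theorem denseRange_embedL : DenseRange S.embedL := by
  intro f
  obtain ⟨w, hf⟩ := S.exists_evalL_eq_inner f
  have hd : (S.inclDomAdjoint.adjoint.range).topologicalClosure = ⊤ := by
    rw [Submodule.topologicalClosure_eq_top_iff, ContinuousLinearMap.orthogonal_range,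
      ContinuousLinearMap.adjoint_adjoint]
    exact LinearMap.ker_eq_bot.2 S.inclDomAdjoint_injective
  have hw' : w ∈ closure (range S.inclDomAdjoint.adjoint) := by
    have : w ∈ (S.inclDomAdjoint.adjoint.range).topologicalClosure := hd ▸ Submodule.mem_top
    exact this
  refine Metric.mem_closure_range_iff.2 fun ε hε => ?_
  obtain ⟨y, hy⟩ := Metric.mem_closure_range_iff.1 hw' (ε / 2) (by positivity)
  refine ⟨y, lt_of_le_of_lt ?_ (half_lt_self hε)⟩
  rw [dist_eq_norm] at hy ⊢
  refine S.norm_le_of_evalL (by positivity) fun v => ?_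
  have : S.evalL v (f - S.embedL y) = inner ℂ v (w - S.inclDomAdjoint.adjoint y) := by
    rw [inner_sub_right, ContinuousLinearMap.adjoint_inner_right, map_sub, hf, evalL_embedL]
  rw [this]
  refine (norm_inner_le_norm (𝕜 := ℂ) v _).trans ?_
  rw [mul_comm]
  gcongr

theorem continuous_extendL : Continuous fun p : ℝ≥0 × S.Extrap => S.extendL p.1 p.2 := by
  refine continuous_uncurry_of_dense S.denseRange_embedL S.extendL (fun a => ?_) ?_
  · obtain ⟨M, -, hM⟩ := S.exists_norm_le a
    exact ⟨M, fun t ht => (S.norm_extendL_le t).trans (hM t ht)⟩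
  · rintro _ ⟨y, rfl⟩
    simp only [extendL_embedL]
    exact S.embedL.continuous.comp (S.continuous_orbit y)

end C0Semigroup

/-! ### Square integrable controls and the input map -/

/-- The Cauchy-Schwarz inequality for the product of the norms of two square integrable
functions. -/
theorem integral_norm_mul_norm_le_sqrt {α E F : Type*} [MeasurableSpace α] {μ : Measure α}
    [NormedAddCommGroup E] [NormedAddCommGroup F] {f : α → E} {g : α → F}
    (hf : MemLp f 2 μ) (hg : MemLp g 2 μ) :
    ∫ a, ‖f a‖ * ‖g a‖ ∂μ ≤ √(∫ a, ‖f a‖ ^ 2 ∂μ) * √(∫ a, ‖g a‖ ^ 2 ∂μ) := by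
  have h := integral_mul_norm_le_Lp_mul_Lq (μ := μ) (f := fun a => ‖f a‖) (g := fun a => ‖g a‖)
    Real.HolderConjugate.two_two (by simpa using hf.norm) (by simpa using hg.norm)
  simpa [Real.sqrt_eq_rpow] using h

theorem norm_sq_Lp_two {α E : Type*} [MeasurableSpace α] {μ : Measure α}
    [NormedAddCommGroup E] [InnerProductSpace ℂ E] (f : Lp E 2 μ) :
    ‖f‖ ^ 2 = ∫ a, ‖f a‖ ^ 2 ∂μ := by
  have h1 := inner_self_eq_norm_sq_to_K (𝕜 := ℂ) f
  rw [L2.inner_def] at h1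
  simp only [inner_self_eq_norm_sq_to_K] at h1
  have h2 : ((∫ a, ‖f a‖ ^ 2 ∂μ : ℝ) : ℂ) = ((‖f‖ ^ 2 : ℝ) : ℂ) := by
    rw [← integral_complex_ofReal]
    push_cast
    exact h1
  exact_mod_cast h2.symm

namespace C0Semigroup

section Control

variable {U : Type*} [NormedAddCommGroup U]

theorem IsControl.memLp {u : ℝ → U} [InnerProductSpace ℂ U] (hu : IsControl u) (T : ℝ) :
    MemLp u 2 (volume.restrict (Ioc 0 T)) := by
  rcases le_or_gt T 0 with h | h
  · rw [Ioc_eq_empty h.not_gt, Measure.restrict_empty]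
    exact ⟨aestronglyMeasurable_zero_measure _, by simp⟩
  · rw [← restrict_Ioo_eq_restrict_Ioc]
    exact hu T h

theorem IsControl.intervalIntegrable {u : ℝ → U} [InnerProductSpace ℂ U] (hu : IsControl u)
    {a b : ℝ} (ha : 0 ≤ a) (hb : 0 ≤ b) : IntervalIntegrable u volume a b := by
  refine intervalIntegrable_iff.2 ?_
  have h1 : IntegrableOn u (Ioc 0 (max a b)) volume :=
    (hu.memLp (max a b)).integrable (by norm_num)
  exact h1.mono_set (Ioc_subset_Ioc_left (le_min ha hb))

end Control

variable {H : Type*} [NormedAddCommGroup H] [InnerProductSpace ℂ H] (S : C0Semigroup H)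
  [CompleteSpace H] {U : Type*} [NormedAddCommGroup U] [InnerProductSpace ℂ U]
  (B : U →L[ℂ] S.Extrap)

theorem intervalIntegrable_extendL {u : ℝ → U} {a b : ℝ} (hu : IntervalIntegrable u volume a b)
    (t : ℝ) : IntervalIntegrable (fun s => S.extendL (t - s).toNNReal (B (u s))) volume a b := by
  obtain ⟨M, hM0, hM⟩ := S.exists_norm_le (t - min a b).toNNReal
  rw [intervalIntegrable_iff] at hu ⊢
  have hm : AEStronglyMeasurable (fun s => S.extendL (t - s).toNNReal (B (u s)))
      (volume.restrict (uIoc a b)) := by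
    have h1 : Continuous fun s : ℝ => (t - s).toNNReal := by fun_prop
    exact Continuous.comp_aestronglyMeasurable
      (g := fun p : ℝ≥0 × S.Extrap => S.extendL p.1 p.2)
      (f := fun s => ((t - s).toNNReal, B (u s))) S.continuous_extendL
      (h1.aestronglyMeasurable.prodMk
        (B.continuous.comp_aestronglyMeasurable hu.aestronglyMeasurable))
  refine Integrable.mono' (hu.norm.const_mul (M * ‖B‖)) hm ?_
  filter_upwards [ae_restrict_mem measurableSet_uIoc] with s hs
  have h1 : ‖S.extendL (t - s).toNNReal‖ ≤ M :=
    (S.norm_extendL_le _).trans (hM _ (Real.toNNReal_le_toNNReal (by have := hs.1; linarith)))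
  refine ((S.extendL _).le_of_opNorm_le h1 _).trans ?_
  rw [mul_assoc]
  gcongr
  exact B.le_opNorm _

/-- The input map `(L u)(t) = ∫_0^t e^{𝒜 (t - s)} B u(s) ds` with values in the extrapolation
space. -/
noncomputable def inputL (u : ℝ → U) (t : ℝ) : S.Extrap :=
  ∫ s in (0 : ℝ)..t, S.extendL (t - s).toNNReal (B (u s))

theorem inputL_congr {u v : ℝ → U} {t : ℝ} (ht : 0 ≤ t)
    (h : ∀ᵐ s ∂volume.restrict (Ioc 0 t), u s = v s) : S.inputL B u t = S.inputL B v t := by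
  rw [inputL, inputL, intervalIntegral.integral_of_le ht, intervalIntegral.integral_of_le ht]
  refine integral_congr_ae ?_
  filter_upwards [h] with s hs
  rw [hs]

theorem inputL_zero {u : ℝ → U} {t : ℝ} (ht : 0 ≤ t)
    (h : ∀ᵐ s ∂volume.restrict (Ioc 0 t), u s = 0) : S.inputL B u t = 0 := by
  rw [S.inputL_congr B (v := 0) ht h]
  simp [inputL]

theorem inputL_add {u v : ℝ → U} {t : ℝ} (hu : IntervalIntegrable u volume 0 t)
    (hv : IntervalIntegrable v volume 0 t) :
    S.inputL B (u + v) t = S.inputL B u t + S.inputL B v t := by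
  rw [inputL, inputL, inputL, ← intervalIntegral.integral_add
    (S.intervalIntegrable_extendL B hu t) (S.intervalIntegrable_extendL B hv t)]
  simp only [Pi.add_apply, map_add]

theorem inputL_smul (c : ℂ) (u : ℝ → U) (t : ℝ) : S.inputL B (c • u) t = c • S.inputL B u t := by
  rw [inputL, inputL, ← intervalIntegral.integral_smul]
  simp only [Pi.smul_apply, map_smul]

/-- The input map at time `t` in terms of its value at time `s ≤ t` and of the control on
`(s, t)`. -/
theorem inputL_split {u : ℝ → U} {s t : ℝ} (hs : 0 ≤ s) (hst : s ≤ t)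
    (hu : IntervalIntegrable u volume 0 s) (hu' : IntervalIntegrable u volume s t) :
    S.inputL B u t = S.extendL (t - s).toNNReal (S.inputL B u s) +
      S.inputL B (fun r => u (r + s)) (t - s) := by
  rw [inputL, ← intervalIntegral.integral_add_adjacent_intervals
    (S.intervalIntegrable_extendL B hu t) (S.intervalIntegrable_extendL B hu' t)]
  congr 1
  · rw [inputL, ← ContinuousLinearMap.intervalIntegral_comp_comm _
      (S.intervalIntegrable_extendL B hu s)]
    refine intervalIntegral.integral_congr fun r hr => ?_
    rw [uIcc_of_le hs] at hr
    rw [← extendL_add, ← Real.toNNReal_add (sub_nonneg.2 hst) (sub_nonneg.2 hr.2)]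
    congr 2
    ring_nf
  · have h1 := intervalIntegral.integral_comp_add_right (a := 0) (b := t - s)
      (fun r => S.extendL (t - r).toNNReal (B (u r))) s
    rw [zero_add, sub_add_cancel] at h1
    rw [← h1, inputL]
    simp only [sub_add_eq_sub_sub_swap]

/-- Once the control is off, the forced part evolves freely. -/
theorem inputL_eq_extendL {u : ℝ → U} {s t : ℝ} (hs : 0 ≤ s) (hst : s ≤ t)
    (hu : IntervalIntegrable u volume 0 s) (hu' : ∀ᵐ r ∂volume.restrict (Ioi s), u r = 0) :
    S.inputL B u t = S.extendL (t - s).toNNReal (S.inputL B u s) := by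
  have h1 : ∀ᵐ r ∂volume.restrict (Ioc s t), u r = 0 :=
    ae_restrict_of_ae_restrict_of_subset Ioc_subset_Ioi_self hu'
  have h2 : ∀ᵐ r ∂volume.restrict (Ioc 0 (t - s)), u (r + s) = 0 := by
    rw [ae_restrict_iff' measurableSet_Ioc] at h1 ⊢
    filter_upwards [(measurePreserving_add_right volume s).quasiMeasurePreserving.ae h1] with r hr
      hr'
    exact hr ⟨by linarith [hr'.1], by linarith [hr'.2]⟩
  have h3 : IntervalIntegrable u volume s t := by
    refine (intervalIntegrable_iff_integrableOn_Ioc_of_le hst).2 ?_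
    exact (integrable_zero _ _ _).congr (h1.mono fun r hr => hr.symm)
  rw [S.inputL_split B hs hst hu h3, S.inputL_zero B (sub_nonneg.2 hst) h2, add_zero]

/-- The input operator with values in the extrapolation space. -/
def inL (B : U →L[ℂ] S.DualDom) : U →L[ℂ] S.Extrap := B

theorem solution_eq (B : U →L[ℂ] S.DualDom) (y : H) (u : ℝ → U) (t : ℝ) :
    S.solution B y u t = S.embedL (S t.toNNReal y) + S.inputL (S.inL B) u t := rfl

end C0Semigroup

/-! ### Lifting operators to `H`, and uniformity from Banach–Steinhaus -/

/-- A bounded operator whose values lie in the range of a bounded injection factors through it. -/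
theorem exists_continuousLinearMap_lift {E F G : Type*} [NormedAddCommGroup E] [NormedSpace ℂ E]
    [CompleteSpace E] [NormedAddCommGroup F] [NormedSpace ℂ F] [CompleteSpace F]
    [NormedAddCommGroup G] [NormedSpace ℂ G] (j : F →L[ℂ] G) (hj : Function.Injective j)
    (Ψ : E →L[ℂ] G) (h : ∀ x, ∃ y, j y = Ψ x) : ∃ Φ : E →L[ℂ] F, ∀ x, j (Φ x) = Ψ x := by
  choose φ hφ using h
  let Φ : E →ₗ[ℂ] F :=
    { toFun := φ
      map_add' := fun x y => hj (by rw [map_add, hφ, hφ, hφ, map_add])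
      map_smul' := fun c x => hj (by rw [map_smul, hφ, hφ, map_smul, RingHom.id_apply]) }
  -- Closed graph theorem: injectivity of `j` describes the graph by a closed equation.
  refine ⟨⟨Φ, Φ.continuous_of_isClosed_graph ?_⟩, hφ⟩
  have : (Φ.graph : Set (E × F)) = {p | j p.2 = Ψ p.1} := by
    ext p
    rw [SetLike.mem_coe, LinearMap.mem_graph_iff]
    exact ⟨fun hp => (congrArg j hp).trans (hφ _), fun hp => hj (Eq.trans hp (hφ _).symm)⟩
  rw [this]
  exact isClosed_eq (j.continuous.comp continuous_snd) (Ψ.continuous.comp continuous_fst)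

/-- If every point of `H` is eventually attained by the operators `π n` on a fixed ball, then one
of them is surjective. -/
theorem exists_surjective_of_forall_eventually {H : Type*} [NormedAddCommGroup H]
    [InnerProductSpace ℂ H] [CompleteSpace H] {X : ℕ → Type*} [∀ n, NormedAddCommGroup (X n)]
    [∀ n, InnerProductSpace ℂ (X n)] [∀ n, CompleteSpace (X n)] (π : ∀ n, X n →L[ℂ] H)
    (h : ∀ y, ∃ (N : ℕ) (c : ℝ), ∀ n ≥ N, ∃ g : X n, π n g = y ∧ ‖g‖ ≤ c) :
    ∃ n, Function.Surjective (π n) := by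
  by_contra! hns
  -- Without such an `x`, the adjoint of `π n` is bounded below, so `π n` composed with its adjoint
  -- is coercive, hence invertible, and `π n` is surjective.
  have key : ∀ n : ℕ, ∃ x : H, ‖x‖ = n + 1 ∧ ‖(π n).adjoint x‖ ≤ 1 := by
    intro n
    have hn : (0 : ℝ) < n + 1 := by positivity
    by_contra! hcon
    have hbound : ∀ x : H, ‖x‖ ≤ (n + 1) * ‖(π n).adjoint x‖ := by
      intro x
      rcases eq_or_ne x 0 with rfl | hx
      · simp
      have hx' : 0 < ‖x‖ := norm_pos_iff.2 hx
      have h1 := hcon ((((n + 1) / ‖x‖ : ℝ) : ℂ) • x) (by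
        rw [norm_smul, Complex.norm_real, Real.norm_of_nonneg (by positivity),
          div_mul_cancel₀ _ hx'.ne'])
      rw [map_smul, norm_smul, Complex.norm_real, Real.norm_of_nonneg (by positivity),
        div_mul_eq_mul_div, one_lt_div hx'] at h1
      exact h1.le
    have hu : IsUnit ((π n).comp (π n).adjoint) := by
      refine ContinuousLinearMap.isUnit_of_forall_le_norm_inner_map _
        (c := (((n : ℝ≥0) + 1) ^ 2)⁻¹) (by positivity) fun x => ?_
      have h1 : inner ℂ (((π n).comp (π n).adjoint) x) x = ((‖(π n).adjoint x‖ ^ 2 : ℝ) : ℂ) := by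
        rw [ContinuousLinearMap.comp_apply, ← ContinuousLinearMap.adjoint_inner_right,
          inner_self_eq_norm_sq_to_K]
        push_cast
        rfl
      rw [h1, Complex.norm_real, Real.norm_of_nonneg (by positivity)]
      push_cast
      rw [mul_inv_le_iff₀ (by positivity), mul_comm, ← mul_pow]
      exact pow_le_pow_left₀ (norm_nonneg _) (hbound x) 2
    refine hns n fun y => ?_
    obtain ⟨x, hx⟩ := (ContinuousLinearMap.isUnit_iff_bijective.1 hu).2 y
    exact ⟨_, hx⟩
  choose x hx hπx using key
  -- For `y = π n g` one has `|⟪x n, y⟫| ≤ ‖(π n)* x n‖ ‖g‖ ≤ c` when `n ≥ N`; the finitely many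
  -- earlier indices are covered by the sum. Pointwise boundedness contradicts `‖x n‖ = n + 1`.
  obtain ⟨C, hC⟩ := banach_steinhaus (g := fun n => innerSL ℂ (x n)) (fun y => by
    obtain ⟨N, c, hc⟩ := h y
    refine ⟨|c| + ∑ i ∈ Finset.range N, ‖(inner ℂ (x i) y : ℂ)‖, fun n => ?_⟩
    rw [innerSL_apply_apply]
    rcases lt_or_ge n N with hn | hn
    · have h1 := Finset.single_le_sum (f := fun i => ‖(inner ℂ (x i) y : ℂ)‖)
        (fun i _ => norm_nonneg _) (Finset.mem_range.2 hn)
      exact h1.trans (le_add_of_nonneg_left (abs_nonneg c))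
    · obtain ⟨g, rfl, hg⟩ := hc n hn
      rw [← ContinuousLinearMap.adjoint_inner_left]
      refine ((norm_inner_le_norm _ _).trans ?_).trans
        (le_add_of_nonneg_right (Finset.sum_nonneg fun i _ => norm_nonneg _))
      calc _ ≤ 1 * c := mul_le_mul (hπx n) hg (norm_nonneg _) zero_le_one
        _ ≤ |c| := (one_mul c).trans_le (le_abs_self c))
  obtain ⟨n, hn⟩ := exists_nat_gt C
  have h1 := hC n
  rw [innerSL_apply_norm, hx] at h1
  linarith

namespace C0Semigroup

variable {H : Type*} [NormedAddCommGroup H] [InnerProductSpace ℂ H] (S : C0Semigroup H)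
  [CompleteSpace H]

variable {S} in
/-- The adjoint of the resolvent maps into `dom A*`. -/
theorem adjoint_resolvent_mem_domAdjoint {z : ℂ} {R : H →L[ℂ] H}
    (hR : ∀ x : S.generator.domain, R (z • (x : H) - S.generator x) = x) (w : H) :
    WithLp.toLp 2 (R.adjoint w, starRingEnd ℂ z • R.adjoint w - w) ∈ S.DomAdjoint := by
  refine (S.mem_domAdjoint_iff _).2 fun x y hxy => ?_
  have h1 := hR ⟨x, _, hxy⟩
  rw [hxy.generator_eq ⟨y, hxy⟩, map_sub, map_smul] at h1
  have h2 : R y = z • R x - x := by rw [eq_sub_iff_add_eq, ← eq_sub_iff_add_eq', h1]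
  change inner ℂ (R.adjoint w) y = inner ℂ (starRingEnd ℂ z • R.adjoint w - w) x
  rw [inner_sub_left, inner_smul_left, ContinuousLinearMap.adjoint_inner_left,
    ContinuousLinearMap.adjoint_inner_left, h2, inner_sub_right, inner_smul_right,
    Complex.conj_conj]

/-- If `y` pairs to zero with `dom A*`, which contains the range of the adjoint resolvent, then `R y
= 0`, and `y = (z - A) R y = 0`. -/
theorem injective_embedL : Function.Injective S.embedL := by
  refine (injective_iff_map_eq_zero _).2 fun y hy => ?_
  obtain ⟨z, R, hR₁, hR₂⟩ := S.exists_mem_resolventSet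
  have h1 : R y = 0 := by
    refine ext_inner_left ℂ fun w => ?_
    have h2 := S.evalL_embedL ⟨_, adjoint_resolvent_mem_domAdjoint hR₂ w⟩ y
    rw [hy, map_zero] at h2
    rw [inner_zero_right, ← ContinuousLinearMap.adjoint_inner_left]
    exact h2.symm
  obtain ⟨hx, hxy⟩ := hR₁ y
  have h2 : (⟨R y, hx⟩ : S.generator.domain) = 0 := Subtype.ext h1
  rw [h2, h1, LinearPMap.map_zero, smul_zero, sub_zero] at hxy
  exact hxy.symm

end C0Semigroup

/-! ### Controls in `L²(0,T;U)` and the states they reach -/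

namespace C0Semigroup

section ExtendZero

variable {U : Type*} [NormedAddCommGroup U]

/-- The extension by zero of an element of `L²(0,T;U)`. -/
noncomputable def extendZero {T : ℝ} (w : Lp U 2 (volume.restrict (Ioo 0 T))) : ℝ → U :=
  (Ioo 0 T).indicator w

variable {T : ℝ} (w : Lp U 2 (volume.restrict (Ioo 0 T)))

theorem memLp_extendZero : MemLp (extendZero w) 2 volume :=
  (memLp_indicator_iff_restrict measurableSet_Ioo).2 (Lp.memLp w)

theorem intervalIntegrable_extendZero (a b : ℝ) :
    IntervalIntegrable (extendZero w) volume a b := by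
  rw [intervalIntegrable_iff, uIoc]
  exact ((memLp_extendZero w).restrict _).integrable (by norm_num)

theorem extendZero_of_ge {r : ℝ} (hr : T ≤ r) : extendZero w r = 0 :=
  indicator_of_notMem (fun h => h.2.not_ge hr) _

theorem ae_extendZero_eq {f : ℝ → U} (hf : w =ᵐ[volume.restrict (Ioo 0 T)] f) :
    extendZero w =ᵐ[volume] (Ioo 0 T).indicator f := by
  rw [ae_eq_restrict_iff_indicator_ae_eq measurableSet_Ioo] at hf
  exact hf

theorem integral_norm_sq_extendZero [InnerProductSpace ℂ U] :
    ∫ r, ‖extendZero w r‖ ^ 2 = ‖w‖ ^ 2 := by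
  rw [norm_sq_Lp_two, ← integral_indicator measurableSet_Ioo]
  congr 1
  ext r
  by_cases hr : r ∈ Ioo 0 T <;> simp [extendZero, hr]

theorem setIntegral_norm_sq_extendZero_le [InnerProductSpace ℂ U] (s : Set ℝ) :
    ∫ r in s, ‖extendZero w r‖ ^ 2 ≤ ‖w‖ ^ 2 := by
  rw [← integral_norm_sq_extendZero]
  exact setIntegral_le_integral (memLp_extendZero w).norm.integrable_sq
    (Eventually.of_forall fun r => by positivity)

end ExtendZero

variable {H : Type*} [NormedAddCommGroup H] [InnerProductSpace ℂ H] (S : C0Semigroup H)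
  [CompleteSpace H] {U : Type*} [NormedAddCommGroup U] [InnerProductSpace ℂ U]
  (B : U →L[ℂ] S.Extrap)

theorem exists_norm_inputL_le (t : ℝ) (ht : 0 ≤ t) : ∃ C : ℝ, 0 ≤ C ∧ ∀ u : ℝ → U,
    IntervalIntegrable u volume 0 t → ‖S.inputL B u t‖ ≤ C * ∫ s in Ioc 0 t, ‖u s‖ := by
  obtain ⟨M, hM0, hM⟩ := S.exists_norm_le t.toNNReal
  refine ⟨M * ‖B‖, by positivity, fun u hu => ?_⟩
  have hu' : IntegrableOn u (Ioc 0 t) := (intervalIntegrable_iff_integrableOn_Ioc_of_le ht).1 hu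
  rw [inputL, intervalIntegral.integral_of_le ht, ← integral_const_mul]
  refine norm_integral_le_of_norm_le (hu'.norm.const_mul _) ?_
  filter_upwards [ae_restrict_mem measurableSet_Ioc] with s hs
  have h1 : ‖S.extendL (t - s).toNNReal‖ ≤ M :=
    (S.norm_extendL_le _).trans (hM _ (Real.toNNReal_le_toNNReal (by linarith [hs.1])))
  refine ((S.extendL _).le_of_opNorm_le h1 _).trans ?_
  rw [mul_assoc]
  gcongr
  exact B.le_opNorm _

/-- The input map at a fixed time as a bounded operator on `L²(0,T;U)`. -/
noncomputable def inputLp (T : ℝ) (t : ℝ≥0) :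
    Lp U 2 (volume.restrict (Ioo 0 T)) →L[ℂ] S.Extrap :=
  LinearMap.mkContinuousOfExistsBound
    { toFun := fun w => S.inputL B (extendZero w) t
      map_add' := fun w w' => by
        rw [← S.inputL_add B (intervalIntegrable_extendZero w 0 t)
          (intervalIntegrable_extendZero w' 0 t)]
        refine S.inputL_congr B t.coe_nonneg (ae_restrict_of_ae ?_)
        filter_upwards [ae_extendZero_eq _ (Lp.coeFn_add w w')] with r hr
        rw [hr, indicator_add']
        rfl
      map_smul' := fun c w => by
        rw [RingHom.id_apply, ← S.inputL_smul B]
        refine S.inputL_congr B t.coe_nonneg (ae_restrict_of_ae ?_)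
        filter_upwards [ae_extendZero_eq _ (Lp.coeFn_smul c w)] with r hr
        exact hr.trans (congrFun (indicator_const_smul (Ioo 0 T) c w) r) }
    (by
      obtain ⟨C, hC0, hC⟩ := S.exists_norm_inputL_le B t t.coe_nonneg
      refine ⟨C * √t, fun w => (hC _ (intervalIntegrable_extendZero w 0 t)).trans ?_⟩
      rw [mul_assoc]
      gcongr
      have h1 := integral_norm_mul_norm_le_sqrt (μ := volume.restrict (Ioc 0 (t : ℝ)))
        (f := fun _ => (1 : ℝ)) (g := extendZero w) (memLp_const 1)
        ((memLp_extendZero w).restrict _)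
      simp only [norm_one, one_mul, one_pow, integral_const, smul_eq_mul, mul_one,
        measureReal_restrict_apply_univ, Real.volume_real_Ioc, sub_zero,
        max_eq_left t.coe_nonneg] at h1
      refine h1.trans ?_
      gcongr
      exact Real.sqrt_le_iff.2 ⟨norm_nonneg _, setIntegral_norm_sq_extendZero_le w _⟩)

theorem inputLp_apply (T : ℝ) (t : ℝ≥0) (w : Lp U 2 (volume.restrict (Ioo 0 T))) :
    S.inputLp B T t w = S.inputL B (extendZero w) t := rfl

variable [CompleteSpace U]

/-- Controls supported away from the final time produce states in `H`. -/
theorem exists_embedL_eq_inputLp {B : U →L[ℂ] S.DualDom} (hB : S.Admissible B) {T : ℝ} {τ : ℝ≥0}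
    (hT : 0 ≤ T) (hτ : T < τ) : ∃ Φ : Lp U 2 (volume.restrict (Ioo 0 T)) →L[ℂ] H,
      ∀ w, S.embedL (Φ w) = S.inputLp (S.inL B) T τ w := by
  refine exists_continuousLinearMap_lift S.embedL S.injective_embedL _ fun w => ?_
  obtain ⟨Λ, hΛ⟩ := hB τ (hT.trans_lt hτ)
  have hm : MemLp (extendZero w) 2 (volume.restrict (Ioo 0 (τ : ℝ))) :=
    (memLp_extendZero w).restrict _
  have h1 : ∀ᵐ t ∂volume.restrict (Ioo T (τ : ℝ)),
      S.embed (Λ (hm.toLp _) t) = S.inputMap B (hm.toLp _) t :=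
    ae_restrict_of_ae_restrict_of_subset (Ioo_subset_Ioo_left hT) (hΛ (hm.toLp _))
  have hne : (ae (volume.restrict (Ioo T (τ : ℝ)))).NeBot := by
    rw [ae_neBot, Ne, Measure.restrict_eq_zero, Real.volume_Ioo]
    simpa using hτ
  -- Admissibility places the state in `H` only at almost every time. A good `t` in `(T, τ)`
  -- suffices: the control is zero after `T`, so the state at `τ` is the free evolution of the state
  -- at `t`.
  obtain ⟨t, ht, htm⟩ := (h1.and (ae_restrict_mem measurableSet_Ioo)).exists
  have ht0 : 0 ≤ t := hT.trans htm.1.le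
  have h2 : S.inputL (S.inL B) (hm.toLp _) t = S.inputL (S.inL B) (extendZero w) t := by
    refine S.inputL_congr _ ht0 ?_
    exact ae_restrict_of_ae_restrict_of_subset (Ioc_subset_Ioo_right htm.2) hm.coeFn_toLp
  have h3 : S.embedL (Λ (hm.toLp _) t) = S.inputL (S.inL B) (extendZero w) t :=
    Eq.trans ht h2
  refine ⟨S (τ - t).toNNReal (Λ (hm.toLp _) t), ?_⟩
  rw [← extendL_embedL, h3, inputLp_apply]
  refine (S.inputL_eq_extendL _ ht0 htm.2.le (intervalIntegrable_extendZero w 0 t) ?_).symm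
  filter_upwards [ae_restrict_mem measurableSet_Ioi] with r hr
  exact extendZero_of_ge w (htm.1.le.trans (le_of_lt hr))

end C0Semigroup

/-! ### Concatenation of controls, and the passage between discrete and continuous time -/

namespace C0Semigroup

variable {H : Type*} [NormedAddCommGroup H] [InnerProductSpace ℂ H] {S : C0Semigroup H}
  [CompleteSpace H] {U : Type*} [NormedAddCommGroup U] [InnerProductSpace ℂ U]
  {B : U →L[ℂ] S.DualDom}

theorem SteersToRest.memLp {y : H} {u : ℝ → U} {T : ℝ} (h : S.SteersToRest B y u T) :
    MemLp u 2 (volume.restrict (Ioi 0)) := by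
  refine (memLp_indicator_iff_restrict measurableSet_Ioi).1 ?_
  refine ((memLp_indicator_iff_restrict measurableSet_Ioc).2 (h.1.memLp T)).ae_eq ?_
  have h1 := (ae_restrict_iff' measurableSet_Ioi).1 h.2.1
  filter_upwards [h1] with r hr
  by_cases h0 : 0 < r
  · rcases le_or_gt r T with hT | hT
    · rw [indicator_of_mem (show r ∈ Ioc 0 T from ⟨h0, hT⟩),
        indicator_of_mem (show r ∈ Ioi 0 from h0)]
    · rw [indicator_of_notMem (fun h => h.2.not_gt hT), indicator_of_mem (show r ∈ Ioi 0 from h0),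
        hr hT]
  · rw [indicator_of_notMem (fun h => h0 h.1),
      indicator_of_notMem (show r ∉ Ioi 0 from fun h => h0 h)]

/-- A control bringing `y` to `y₁` can be followed by a control steering `y₁` to the rest. -/
theorem SteersToRest.concat {y y₁ : H} {T : ℝ} {τ : ℝ≥0} (hT : T ≤ τ)
    (w : Lp U 2 (volume.restrict (Ioo 0 T)))
    (hw : S.embedL (S τ y) + S.inputLp (S.inL B) T τ w = S.embedL y₁) {v : ℝ → U} {T' : ℝ}
    (hT' : 0 < T') (hv : S.SteersToRest B y₁ v T') :
    ∃ u : ℝ → U, S.SteersToRest B y u (τ + T') ∧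
      ∫ s in Ioi (0 : ℝ), ‖u s‖ ^ 2 ≤ ‖w‖ ^ 2 + ∫ s in Ioi (0 : ℝ), ‖v s‖ ^ 2 := by
  -- Values of `v` at negative times are arbitrary; cutting them off keeps the shifted copy from
  -- overlapping `w`, so the energies add.
  set v' : ℝ → U := (Ioi 0).indicator v with hv'
  have hv'm : MemLp v' 2 volume := (memLp_indicator_iff_restrict measurableSet_Ioi).2 hv.memLp
  have hmp : MeasurePreserving (fun r : ℝ => r - τ) volume volume :=
    measurePreserving_sub_right volume (τ : ℝ)
  have hsm : MemLp (fun r => v' (r - τ)) 2 volume := hv'm.comp_measurePreserving hmp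
  set u : ℝ → U := fun r => extendZero w r + v' (r - τ) with hu
  have hum : MemLp u 2 volume := (memLp_extendZero w).add hsm
  have hv'0 : ∀ r ≤ 0, v' r = 0 := fun r hr => indicator_of_notMem (fun h => hr.not_gt h) _
  have hule : ∀ r ≤ (τ : ℝ), u r = extendZero w r := fun r hr => by
    rw [hu]
    simp only
    rw [hv'0 _ (by linarith), add_zero]
  have huge : ∀ r > (τ : ℝ), u r = v (r - τ) := fun r hr => by
    rw [hu]
    simp only
    rw [extendZero_of_ge w (hT.trans hr.le), zero_add, hv',
      indicator_of_mem (show r - τ ∈ Ioi 0 from sub_pos.2 hr)]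
  have hctrl : IsControl u := fun _ _ => hum.restrict _
  have hint : ∀ {a b : ℝ}, 0 ≤ a → 0 ≤ b → IntervalIntegrable u volume a b :=
    hctrl.intervalIntegrable
  have hsol : ∀ t > (τ : ℝ), S.solution B y u t = S.solution B y₁ v (t - τ) := by
    intro t ht
    have ht0 : 0 ≤ t - τ := sub_nonneg.2 ht.le
    have e1 : S.inputL (S.inL B) u τ = S.inputLp (S.inL B) T τ w := by
      rw [inputLp_apply]
      refine S.inputL_congr _ τ.coe_nonneg ?_
      filter_upwards [ae_restrict_mem measurableSet_Ioc] with r hr using hule r hr.2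
    have e2 : S.inputL (S.inL B) (fun r => u (r + τ)) (t - τ) =
        S.inputL (S.inL B) v (t - τ) := by
      refine S.inputL_congr _ ht0 ?_
      filter_upwards [ae_restrict_mem measurableSet_Ioc] with r hr
      rw [huge _ (by linarith [hr.1]), add_sub_cancel_right]
    have e3 : t.toNNReal = (t - τ).toNNReal + τ := by
      rw [← Real.toNNReal_coe (r := τ), ← Real.toNNReal_add (by simpa using ht.le) (by simp)]
      simp
    refine (S.solution_eq B y u t).trans ((?_ : _ = _).trans (S.solution_eq B y₁ v _).symm)
    rw [S.inputL_split _ τ.coe_nonneg ht.le (hint le_rfl τ.coe_nonneg)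
      (hint τ.coe_nonneg (τ.coe_nonneg.trans ht.le)), e1, e2, e3, S.add_apply, ← extendL_embedL,
      ← add_assoc, ← map_add, hw, extendL_embedL]
  have hshift : ∀ {p : ℝ → Prop}, (∀ᵐ r ∂volume.restrict (Ioi T'), p r) →
      ∀ᵐ r ∂volume.restrict (Ioi (τ + T')), p (r - τ) := by
    intro p hp
    rw [ae_restrict_iff' measurableSet_Ioi] at hp ⊢
    filter_upwards [hmp.quasiMeasurePreserving.ae hp] with r hr hr'
    exact hr (by rw [mem_Ioi] at hr' ⊢; linarith)
  refine ⟨u, ⟨hctrl, ?_, ?_⟩, ?_⟩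
  · filter_upwards [hshift hv.2.1, ae_restrict_mem measurableSet_Ioi] with r hr hr'
    rw [mem_Ioi] at hr'
    rw [huge r (by linarith), hr]
  · filter_upwards [hshift hv.2.2, ae_restrict_mem measurableSet_Ioi] with r hr hr'
    rw [mem_Ioi] at hr'
    rw [hsol r (by linarith), hr]
  · have hsq : ∀ r, ‖u r‖ ^ 2 = ‖extendZero w r‖ ^ 2 + ‖v' (r - τ)‖ ^ 2 := fun r => by
      rcases le_or_gt r τ with hr | hr
      · rw [hule r hr, hv'0 _ (by linarith)]
        simp
      · rw [huge r hr, extendZero_of_ge w (hT.trans hr.le), hv',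
          indicator_of_mem (show r - τ ∈ Ioi 0 from sub_pos.2 hr)]
        simp
    calc ∫ s in Ioi (0 : ℝ), ‖u s‖ ^ 2 ≤ ∫ s, ‖u s‖ ^ 2 :=
          setIntegral_le_integral hum.norm.integrable_sq
            (Eventually.of_forall fun r => by positivity)
      _ = ‖w‖ ^ 2 + ∫ s, ‖v' (s - τ)‖ ^ 2 := by
          simp only [hsq]
          rw [integral_add (memLp_extendZero w).norm.integrable_sq hsm.norm.integrable_sq,
            integral_norm_sq_extendZero]
      _ = ‖w‖ ^ 2 + ∫ s in Ioi (0 : ℝ), ‖v s‖ ^ 2 := by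
          rw [integral_sub_right_eq_self (fun s => ‖v' s‖ ^ 2),
            ← integral_indicator measurableSet_Ioi]
          congr 2
          ext r
          by_cases hr : r ∈ Ioi (0 : ℝ)
          · rw [hv', indicator_of_mem hr, indicator_of_mem hr]
          · rw [hv', indicator_of_notMem hr, indicator_of_notMem hr]
            simp

theorem steersToRest_zero : S.SteersToRest B 0 (0 : ℝ → U) 1 := by
  refine ⟨fun _ _ => MemLp.zero, Eventually.of_forall fun _ => rfl, ?_⟩
  filter_upwards [ae_restrict_mem measurableSet_Ioi] with t ht
  rw [mem_Ioi] at ht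
  refine (S.solution_eq B _ _ _).trans ?_
  rw [map_zero, map_zero, zero_add]
  exact S.inputL_zero _ (zero_le_one.trans ht.le) (Eventually.of_forall fun _ => rfl)

/-- A discrete-time control yields a continuous-time control of the same cost. -/
theorem exists_steersToRest_of_steerCost {T : ℝ} {τ : ℝ≥0} (hT : T ≤ τ)
    {Φ : Lp U 2 (volume.restrict (Ioo 0 T)) →L[ℂ] H}
    (hΦ : ∀ w, S.embedL (Φ w) = S.inputLp (S.inL B) T τ w) {n : ℕ} {y : H} {c : ℝ}
    (h : SteerCost (S τ) Φ n y c) : ∃ T' : ℝ, 0 < T' ∧ ∃ u : ℝ → U,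
      S.SteersToRest B y u T' ∧ ∫ s in Ioi (0 : ℝ), ‖u s‖ ^ 2 ≤ c ^ 2 := by
  induction n generalizing y c with
  | zero =>
    obtain ⟨rfl, -⟩ := h
    exact ⟨1, one_pos, 0, steersToRest_zero, by simpa using sq_nonneg c⟩
  | succ n ih =>
    obtain ⟨-, w, c', h1, h2⟩ := h
    obtain ⟨T', hT', v, hv, hvc⟩ := ih h1
    obtain ⟨u, hu, huc⟩ := SteersToRest.concat hT w (by rw [← hΦ, ← map_add]) hT' hv
    exact ⟨τ + T', add_pos_of_nonneg_of_pos τ.coe_nonneg hT', u, hu, by linarith⟩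

/-- The solution vanishes at every time after the steering time. -/
theorem SteersToRest.solution_eq_zero {y : H} {u : ℝ → U} {T : ℝ} (hT : 0 < T)
    (h : S.SteersToRest B y u T) {t : ℝ≥0} (ht : T < t) :
    S.embedL (S t y) + S.inputL (S.inL B) u t = 0 := by
  have hne : (ae (volume.restrict (Ioo T (t : ℝ)))).NeBot := by
    rw [ae_neBot, Ne, Measure.restrict_eq_zero, Real.volume_Ioo]
    simpa using ht
  have hsub : Ioo T (t : ℝ) ⊆ Ioi T := Ioo_subset_Ioi_self
  -- The solution vanishes only almost everywhere after `T`; from a time `s` where it does vanish,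
  -- free evolution carries zero to `t`.
  obtain ⟨s, hs, hsm⟩ := ((ae_restrict_of_ae_restrict_of_subset hsub h.2.2).and
    (ae_restrict_mem measurableSet_Ioo)).exists
  have hs0 : 0 ≤ s := hT.le.trans hsm.1.le
  have h2 : S.inputL (S.inL B) u t =
      S.extendL (t - s).toNNReal (S.inputL (S.inL B) u s) :=
    S.inputL_eq_extendL _ hs0 hsm.2.le (h.1.intervalIntegrable le_rfl hs0)
      (ae_restrict_of_ae_restrict_of_subset (Ioi_subset_Ioi hsm.1.le) h.2.1)
  have h3 : S.embedL (S s.toNNReal y) + S.inputL (S.inL B) u s = 0 := hs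
  have h4 : t = (t - s).toNNReal + s.toNNReal := by
    rw [← Real.toNNReal_add (sub_nonneg.2 hsm.2.le) hs0, sub_add_cancel, Real.toNNReal_coe]
  have h5 : S t y = S (t - s).toNNReal (S s.toNNReal y) := by
    rw [← S.add_apply, ← h4]
  rw [h2, h5, ← extendL_embedL, ← map_add, h3, map_zero]

/-- A control steering `y` to the rest, restricted to a longer time interval. -/
theorem SteersToRest.exists_inputLp {y : H} {u : ℝ → U} {T : ℝ} (hT : 0 < T)
    (h : S.SteersToRest B y u T) {t : ℝ≥0} (ht : T < t) :
    ∃ w : Lp U 2 (volume.restrict (Ioo 0 (t : ℝ))),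
      S.embedL (S t y) + S.inputLp (S.inL B) t t w = 0 ∧
      ‖w‖ ≤ √(∫ s in Ioi (0 : ℝ), ‖u s‖ ^ 2) := by
  have hm := h.1 t (hT.trans ht)
  refine ⟨hm.toLp _, ?_, ?_⟩
  · have h1 : S.inputLp (S.inL B) t t (hm.toLp _) = S.inputL (S.inL B) u t := by
      rw [inputLp_apply]
      refine S.inputL_congr _ t.coe_nonneg ?_
      rw [← restrict_Ioo_eq_restrict_Ioc]
      filter_upwards [hm.coeFn_toLp, ae_restrict_mem measurableSet_Ioo] with r hr hr'
      rw [extendZero, indicator_of_mem hr', hr]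
    rw [h1]
    exact h.solution_eq_zero hT ht
  · refine Real.le_sqrt_of_sq_le ?_
    rw [norm_sq_Lp_two]
    have h1 : ∫ r in Ioo 0 (t : ℝ), ‖hm.toLp u r‖ ^ 2 = ∫ r in Ioo 0 (t : ℝ), ‖u r‖ ^ 2 := by
      refine integral_congr_ae ?_
      filter_upwards [hm.coeFn_toLp] with r hr
      rw [hr]
    rw [h1]
    exact setIntegral_mono_set h.memLp.norm.integrable_sq
      (Eventually.of_forall fun r => by positivity) Ioo_subset_Ioi_self.eventuallyLE

/-- Null controllability is uniform: all states can be steered to the rest within a common time,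
by controls whose norm is bounded by that of the state. -/
theorem NullControllable.exists_uniform [CompleteSpace U] (h : S.NullControllable B) (N : ℕ) :
    ∃ n : ℕ, N ≤ n ∧ ∃ C : ℝ, 0 ≤ C ∧ ∀ y : H,
      ∃ w : Lp U 2 (volume.restrict (Ioo 0 ((n : ℝ≥0) : ℝ))),
        S.embedL (S n y) + S.inputLp (S.inL B) (n : ℝ≥0) n w = 0 ∧ ‖w‖ ≤ C * ‖y‖ := by
  -- The shift by `N` guarantees a final time at least `N`.
  let W : ℕ → Type _ := fun n => Lp U 2 (volume.restrict (Ioo 0 (((n + N : ℕ) : ℝ≥0) : ℝ)))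
  let L : ∀ n, WithLp 2 (H × W n) →L[ℂ] S.Extrap := fun n =>
    (S.embedL.comp (S ((n + N : ℕ) : ℝ≥0))).comp (WithLp.fstL 2 ℂ H (W n)) +
      (S.inputLp (S.inL B) (((n + N : ℕ) : ℝ≥0) : ℝ) ((n + N : ℕ) : ℝ≥0)).comp
        (WithLp.sndL 2 ℂ H (W n))
  -- `X n` consists of the pairs `(y, w)` for which `w` brings `y` to zero at time `n + N`. Once the
  -- projection to `y` is onto for some `n`, the open mapping theorem provides the cost bound.
  let X : ∀ n, Submodule ℂ (WithLp 2 (H × W n)) := fun n => (L n).ker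
  have hX : ∀ n, CompleteSpace (X n) := fun n => (L n).isClosed_ker.completeSpace_coe
  let π : ∀ n, X n →L[ℂ] H := fun n => (WithLp.fstL 2 ℂ H (W n)).comp (X n).subtypeL
  obtain ⟨n, hn⟩ := exists_surjective_of_forall_eventually π (fun y => by
    obtain ⟨T, hT, u, hu⟩ := h y
    refine ⟨⌈T⌉₊ + 1, √(‖y‖ ^ 2 + √(∫ s in Ioi (0 : ℝ), ‖u s‖ ^ 2) ^ 2), fun n hn => ?_⟩
    have ht : T < (((n + N : ℕ) : ℝ≥0) : ℝ) := by
      have h1 := Nat.le_ceil T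
      have h2 : ((⌈T⌉₊ + 1 : ℕ) : ℝ) ≤ ((n + N : ℕ) : ℝ) := by
        exact_mod_cast (show ⌈T⌉₊ + 1 ≤ n + N by omega)
      push_cast at h2 ⊢
      linarith
    obtain ⟨w, hw, hwn⟩ := hu.exists_inputLp hT ht
    refine ⟨⟨WithLp.toLp 2 (y, w), hw⟩, rfl, ?_⟩
    refine Real.le_sqrt_of_sq_le ?_
    have h3 : ‖(WithLp.toLp 2 (y, w) : WithLp 2 (H × W n))‖ ^ 2 = ‖y‖ ^ 2 + ‖w‖ ^ 2 :=
      WithLp.prod_norm_sq_eq_of_L2 _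
    refine h3.trans_le ?_
    gcongr)
  obtain ⟨C, hC, hCy⟩ := (π n).exists_preimage_norm_le hn
  refine ⟨n + N, Nat.le_add_left _ _, C, hC.le, fun y => ?_⟩
  obtain ⟨g, hg, hgn⟩ := hCy y
  refine ⟨(g : WithLp 2 (H × W n)).snd, ?_, ?_⟩
  · have h1 : L n g = 0 := g.2
    have h2 : (g : WithLp 2 (H × W n)).fst = y := hg
    rw [← h2]
    exact h1
  · exact (WithLp.norm_snd_le H (g : WithLp 2 (H × W n))).trans hgn

/-- For an eventually compact semigroup with `s(A) ≤ 0`, null controllability implies null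
controllability with vanishing energy. -/
theorem NullControllable.ncve [CompleteSpace U] (hB : S.Admissible B) (hS : S.EventuallyCompact)
    (hs : S.spectralBound ≤ 0) (h : S.NullControllable B) : S.NCVE B := by
  obtain ⟨t₀, -, hcomp⟩ := hS
  obtain ⟨n, hn, C, hC, hw⟩ := h.exists_uniform ⌈t₀⌉₊
  -- Controls act on `(0, n)` and the last unit of time is free, so that the reached states lie in
  -- `H`.
  set τ : ℝ≥0 := 1 + n with hτ
  have hτ0 : 0 < τ := by positivity
  have hτn : ((n : ℝ≥0) : ℝ) < τ := by rw [hτ]; push_cast; linarith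
  have hτc : IsCompactOperator (S τ) := by
    refine hcomp τ ?_
    have h1 := Nat.le_ceil t₀
    have h2 : ((⌈t₀⌉₊ : ℕ) : ℝ≥0) ≤ n := by exact_mod_cast hn
    exact (h1.trans h2).trans (by rw [hτ]; simp)
  obtain ⟨Φ, hΦ⟩ := S.exists_embedL_eq_inputLp hB (n : ℝ≥0).coe_nonneg hτn
  have hKΦ : ∀ y, ∃ w, S τ y + Φ w = 0 ∧ ‖w‖ ≤ C * ‖y‖ := fun y => by
    obtain ⟨w, hw1, hw2⟩ := hw y
    refine ⟨w, S.injective_embedL ?_, hw2⟩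
    have h1 : S.inputL (S.inL B) (extendZero w) τ =
        S.extendL ((τ : ℝ) - (n : ℝ≥0)).toNNReal (S.inputL (S.inL B) (extendZero w) (n : ℝ≥0)) := by
      refine S.inputL_eq_extendL _ (n : ℝ≥0).coe_nonneg hτn.le
        (intervalIntegrable_extendZero w _ _) ?_
      filter_upwards [ae_restrict_mem measurableSet_Ioi] with r hr
      exact extendZero_of_ge w (le_of_lt hr)
    have h2 : ((τ : ℝ) - (n : ℝ≥0)).toNNReal = 1 := by rw [hτ]; simp
    rw [map_add, hΦ, inputLp_apply, h1, h2, hτ, S.add_apply, ← extendL_embedL, ← map_add,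
      ← inputLp_apply, hw1, map_zero, map_zero]
  intro y ε hε
  have h0 := steerInf_eq_zero hC hKΦ hτc (S.spectralRadius_le_one hs hτ0 hτc) y
  obtain ⟨m, hm⟩ := exists_steerCost_lt hC hKΦ y (h0.trans_lt hε)
  exact exists_steersToRest_of_steerCost hτn.le hΦ hm

end C0Semigroup

/-! ### Unstable eigenvectors and the lower bound on the energy -/

namespace C0Semigroup

variable {H : Type*} [NormedAddCommGroup H] [InnerProductSpace ℂ H] (S : C0Semigroup H)
  [CompleteSpace H]

/-- An eigenvector of `S(τ)*` can be replaced by one in `dom A*`. -/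
theorem exists_domAdjoint_eigenvector {τ : ℝ≥0} {ω : ℂ} {v : H} (hv : v ≠ 0)
    (h : (S τ).adjoint v = ω • v) : ∃ p : S.DomAdjoint, p ≠ 0 ∧ S.adjointOnDom τ p = ω • p := by
  obtain ⟨z, R, hR₁, hR₂⟩ := S.exists_mem_resolventSet
  -- The adjoint of the resolvent commutes with `S(τ)*`, so it maps `v` to an eigenvector in `dom
  -- A*`, nonzero because `R` has dense range.
  have hcomm : ∀ x, R (S τ x) = S τ (R x) := fun x => by
    obtain ⟨hx, hxe⟩ := hR₁ x
    have h1 := hR₂ ⟨S τ (R x), S.map_mem_domain τ ⟨R x, hx⟩⟩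
    rw [S.generator_map τ ⟨R x, hx⟩] at h1
    simp only at h1
    rwa [← map_smul, ← map_sub, hxe] at h1
  have hadj : (S τ).adjoint (R.adjoint v) = ω • R.adjoint v := by
    rw [← map_smul, ← h]
    refine ext_inner_right ℂ fun x => ?_
    simp only [ContinuousLinearMap.adjoint_inner_left, hcomm]
  refine ⟨⟨_, adjoint_resolvent_mem_domAdjoint hR₂ v⟩, fun h0 => hv ?_,
    S.inclDomAdjoint_injective ?_⟩
  · have h1 : R.adjoint v = 0 := congrArg S.inclDomAdjoint h0
    refine S.dense_domain.eq_zero_of_inner_left ℂ fun x hx => ?_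
    have h2 := hR₂ ⟨x, hx⟩
    simp only at h2
    rw [← h2, ← ContinuousLinearMap.adjoint_inner_left, h1, inner_zero_left]
  · rw [map_smul, inclDomAdjoint_adjointOnDom]
    exact hadj

theorem adjointOnDom_nsmul_eigenvector {τ : ℝ≥0} {ω : ℂ} {p : S.DomAdjoint}
    (hp : S.adjointOnDom τ p = ω • p) (k : ℕ) : S.adjointOnDom (k * τ) p = ω ^ k • p := by
  induction k with
  | zero => simp [adjointOnDom_zero]
  | succ k ih =>
    rw [Nat.cast_succ, add_mul, one_mul, adjointOnDom_add, hp, map_smul, ih, smul_smul, pow_succ']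

/-- The growth of the orbit of an eigenvector of `S(τ)*`. -/
theorem exists_norm_adjointOnDom_le {τ : ℝ≥0} (hτ : 0 < τ) {ω : ℂ} (hω : 1 < ‖ω‖)
    {p : S.DomAdjoint} (hp : S.adjointOnDom τ p = ω • p) : ∃ M : ℝ, 0 ≤ M ∧ ∀ r : ℝ≥0,
      ‖S.adjointOnDom r p‖ ≤ M * Real.exp (Real.log ‖ω‖ / τ * r) := by
  obtain ⟨M, hM0, hM⟩ := S.exists_norm_le τ
  refine ⟨M * ‖p‖, by positivity, fun r => ?_⟩
  have hτr : (0 : ℝ) < τ := hτ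
  -- Write `r = r' + jτ` with `r' ≤ τ`: the eigenvalue accounts for `j` periods and local
  -- boundedness for the remainder.
  obtain ⟨j, hj⟩ : ∃ j : ℕ, j = ⌊(r : ℝ) / τ⌋₊ := ⟨_, rfl⟩
  have hj1 : (j : ℝ) * τ ≤ r := by
    rw [hj, ← le_div_iff₀ hτr]
    exact Nat.floor_le (by positivity)
  have hj2 : (r : ℝ) < (j + 1) * τ := by
    rw [hj, ← div_lt_iff₀ hτr]
    exact Nat.lt_floor_add_one _
  have hle : (j : ℝ≥0) * τ ≤ r := by exact_mod_cast hj1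
  obtain ⟨r', hr'⟩ : ∃ r', r' = r - j * τ := ⟨_, rfl⟩
  have hr : r = r' + j * τ := by rw [hr', tsub_add_cancel_of_le hle]
  have hr'τ : r' ≤ τ := by
    rw [hr', tsub_le_iff_right]
    have : (r : ℝ) ≤ τ + j * τ := by linarith
    exact_mod_cast this
  have h1 : S.adjointOnDom r p = ω ^ j • S.adjointOnDom r' p := by
    rw [hr, adjointOnDom_add, S.adjointOnDom_nsmul_eigenvector hp, map_smul]
  have h2 : ‖S.adjointOnDom r' p‖ ≤ M * ‖p‖ :=
    (S.adjointOnDom r').le_of_opNorm_le ((S.norm_adjointOnDom_le r').trans (hM r' hr'τ)) p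
  have h3 : ‖ω‖ ^ j ≤ Real.exp (Real.log ‖ω‖ / τ * r) := by
    rw [← Real.exp_log (pow_pos (zero_lt_one.trans hω) j), Real.log_pow]
    refine Real.exp_le_exp.2 ?_
    rw [div_mul_eq_mul_div, le_div_iff₀ hτr]
    nlinarith [Real.log_pos hω]
  rw [h1, norm_smul, norm_pow, mul_comm]
  exact mul_le_mul h2 h3 (by positivity) (by positivity)

variable {U : Type*} [NormedAddCommGroup U] [InnerProductSpace ℂ U]

variable {S} in
/-- The energy needed to steer to the rest a state with a component along an unstable eigenvector
of `S(τ)*` is bounded below. -/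
theorem SteersToRest.exists_norm_inner_le (B : U →L[ℂ] S.DualDom)
    {τ : ℝ≥0} (hτ : 0 < τ) {ω : ℂ} (hω : 1 < ‖ω‖)
    {p : S.DomAdjoint} (hp : S.adjointOnDom τ p = ω • p) : ∃ C : ℝ, 0 ≤ C ∧
      ∀ (y : H) (u : ℝ → U) (T : ℝ), 0 < T → S.SteersToRest B y u T →
        ‖(inner ℂ (S.inclDomAdjoint p) y : ℂ)‖ ≤ C * √(∫ s in Ioi (0 : ℝ), ‖u s‖ ^ 2) := by
  obtain ⟨M, hM0, hM⟩ := S.exists_norm_adjointOnDom_le hτ hω hp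
  have hτr : (0 : ℝ) < τ := hτ
  set a : ℝ := Real.log ‖ω‖ / τ with ha
  have ha0 : 0 < a := div_pos (Real.log_pos hω) hτr
  set b : ℝ := ‖S.inL B‖ with hb
  have hb0 : 0 ≤ b := norm_nonneg _
  -- Pairing the vanishing solution at time `t` with `p` gives `e^{at} |⟪p, y⟫| ≤ M b ∫ e^{a(t-s)}
  -- ‖u s‖ ds`. The factor `e^{at}` cancels, and Cauchy–Schwarz leaves the `L²` norm of `e^{-as}`,
  -- independent of the steering time.
  refine ⟨M * b * √(∫ s in Ioi (0 : ℝ), ‖Real.exp (-a * s)‖ ^ 2), by positivity,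
    fun y u T hT hu => ?_⟩
  have hexp : MemLp (fun s : ℝ => Real.exp (-a * s)) 2 (volume.restrict (Ioi 0)) := by
    refine (memLp_two_iff_integrable_sq (by fun_prop)).2 ?_
    refine (integrableOn_exp_mul_Ioi (a := -(2 * a)) (by linarith) 0).congr
      (Eventually.of_forall fun s => ?_)
    simp only
    rw [← Real.exp_nat_mul]
    congr 1
    push_cast
    ring
  have hprod : IntegrableOn (fun s : ℝ => ‖Real.exp (-a * s)‖ * ‖u s‖) (Ioi 0) :=
    hexp.norm.integrable_mul hu.memLp.norm
  have hCS := integral_norm_mul_norm_le_sqrt hexp hu.memLp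
  -- A multiple of `τ` beyond `T` makes the growth factor exactly `|ω| ^ k = e^{at}`.
  obtain ⟨k, hk⟩ := exists_nat_gt (T / τ)
  rw [div_lt_iff₀ hτr] at hk
  set t : ℝ≥0 := k * τ with ht
  have htT : T < t := by rw [ht]; push_cast; exact hk
  have hsol := hu.solution_eq_zero hT htT
  have h1 : S.evalL p (S.embedL (S t y)) = S.evalL (ω ^ k • p) (S.embedL y) := by
    rw [← extendL_embedL, evalL_extendL, S.adjointOnDom_nsmul_eigenvector hp]
  have h2 : ‖S.evalL p (S.embedL (S t y))‖ =
      ‖ω‖ ^ k * ‖(inner ℂ (S.inclDomAdjoint p) y : ℂ)‖ := by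
    rw [h1, evalL_embedL, map_smul, inner_smul_left, norm_mul, RCLike.norm_conj, norm_pow]
  have hωk : ‖ω‖ ^ k = Real.exp (a * t) := by
    rw [← Real.exp_log (pow_pos (zero_lt_one.trans hω) k), Real.log_pow, ha, ht]
    push_cast
    congr 1
    field_simp
  have hii : IntervalIntegrable u volume 0 t := hu.1.intervalIntegrable le_rfl t.coe_nonneg
  have h3 : ‖S.evalL p (S.inputL (S.inL B) u t)‖ ≤
      M * b * Real.exp (a * t) * ∫ s in Ioi (0 : ℝ), ‖Real.exp (-a * s)‖ * ‖u s‖ := by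
    rw [inputL, ← ContinuousLinearMap.intervalIntegral_comp_comm _
      (S.intervalIntegrable_extendL _ hii t), intervalIntegral.integral_of_le t.coe_nonneg]
    have h4 : ∀ᵐ s ∂volume.restrict (Ioc 0 (t : ℝ)),
        ‖S.evalL p (S.extendL ((t : ℝ) - s).toNNReal (S.inL B (u s)))‖ ≤
          M * b * Real.exp (a * t) * (‖Real.exp (-a * s)‖ * ‖u s‖) := by
      filter_upwards [ae_restrict_mem measurableSet_Ioc] with s hs
      rw [evalL_extendL]
      refine ((S.evalL _).le_of_opNorm_le ((S.norm_evalL_le _).trans (hM _)) _).trans ?_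
      rw [Real.coe_toNNReal _ (sub_nonneg.2 hs.2), Real.norm_of_nonneg (Real.exp_pos _).le]
      have h5 : Real.exp (a * (t - s)) = Real.exp (a * t) * Real.exp (-a * s) := by
        rw [← Real.exp_add]; ring_nf
      have h6 := (S.inL B).le_opNorm (u s)
      rw [h5]
      calc _ ≤ M * (Real.exp (a * t) * Real.exp (-a * s)) * (b * ‖u s‖) := by gcongr
        _ = _ := by ring
    refine (norm_integral_le_of_norm_le ((hprod.mono_set Ioc_subset_Ioi_self).const_mul _)
      h4).trans ?_
    rw [integral_const_mul]
    gcongr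
    · exact Eventually.of_forall fun s => by positivity
    · exact Ioc_subset_Ioi_self
  have h4 : S.evalL p (S.embedL (S t y)) = -S.evalL p (S.inputL (S.inL B) u t) := by
    rw [eq_neg_iff_add_eq_zero, ← map_add, hsol, map_zero]
  rw [h4, norm_neg, hωk] at h2
  rw [h2] at h3
  have h5 : ‖(inner ℂ (S.inclDomAdjoint p) y : ℂ)‖ ≤
      M * b * ∫ s in Ioi (0 : ℝ), ‖Real.exp (-a * s)‖ * ‖u s‖ := by
    refine le_of_mul_le_mul_left (h3.trans_eq ?_) (Real.exp_pos (a * t))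
    ring
  refine h5.trans ?_
  rw [mul_assoc (M * b)]
  gcongr

variable {S} in
theorem not_ncve_of_spectralBound_pos (B : U →L[ℂ] S.DualDom)
    (hS : S.EventuallyCompact) (hs : 0 < S.spectralBound) : ¬ S.NCVE B := by
  intro h
  obtain ⟨τ, hτ, ω, hω, v, hv, hvω⟩ := S.exists_adjoint_eigenvector hs hS
  obtain ⟨p, hp0, hp⟩ := S.exists_domAdjoint_eigenvector hv hvω
  obtain ⟨C, hC0, hC⟩ := SteersToRest.exists_norm_inner_le B hτ hω hp
  set q := S.inclDomAdjoint p with hq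
  have hq0 : 0 < ‖q‖ := norm_pos_iff.2 fun h0 =>
    hp0 (S.inclDomAdjoint_injective (h0.trans (map_zero _).symm))
  -- For the initial state `q` itself the lower bound reads `‖q‖² ≤ C ε`, which fails at this `ε`
  -- because `C / (C + 1) < 1`.
  have hε : 0 < ‖q‖ ^ 2 / (C + 1) := by positivity
  obtain ⟨T, hT, u, hu, hue⟩ := h q _ hε
  have h1 := hC q u T hT hu
  have h2 : √(∫ s in Ioi (0 : ℝ), ‖u s‖ ^ 2) ≤ ‖q‖ ^ 2 / (C + 1) :=
    (Real.sqrt_le_sqrt hue).trans_eq (Real.sqrt_sq hε.le)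
  rw [inner_self_eq_norm_sq_to_K, norm_pow, RCLike.norm_ofReal, abs_norm] at h1
  have h3 : ‖q‖ ^ 2 ≤ C * (‖q‖ ^ 2 / (C + 1)) := h1.trans (by gcongr)
  rw [mul_div_assoc', le_div_iff₀ (by positivity)] at h3
  nlinarith [pow_pos hq0 2]

theorem NCVE.nullControllable {S : C0Semigroup H} {B : U →L[ℂ] S.DualDom}
    (h : S.NCVE B) : S.NullControllable B := fun y => by
  obtain ⟨T, hT, u, hu, -⟩ := h y 1 one_pos
  exact ⟨T, hT, u, hu⟩

end C0Semigroup

theorem mainTheorem3 {H U : Type*}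
    [NormedAddCommGroup H] [InnerProductSpace ℂ H] [CompleteSpace H]
    [NormedAddCommGroup U] [InnerProductSpace ℂ U] [CompleteSpace U]
    (S : C0Semigroup H) (B : U →L[ℂ] S.DualDom)
    (hB : S.Admissible B) (hS : S.EventuallyCompact) :
    (S.spectralBound ≤ 0 → (S.NullControllable B ↔ S.NCVE B)) ∧
    (0 < S.spectralBound → ¬ S.NCVE B) :=
  ⟨fun hs => ⟨fun h => h.ncve hB hS hs, fun h => h.nullControllable⟩,
    fun hs => C0Semigroup.not_ncve_of_spectralBound_pos B hS hs⟩
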